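/- For a simplicial complex $K$ whose vertex set is a set $V$ with $N+1$ elements, a missing face of $K$ is an inclusion-minimal nonempty subset of $V$ that is not a face of $K$. Let $\Delta_N$ be the full simplex on $V$, and let $\mathrm{KG}^2(K,\Delta_N)$ be the graph whose vertices are the missing faces of $K$, with an edge between two missing faces if and only if they are disjoint. (1) Let $d\ge 1$, $N \ge 0$ and let $K$ be a triangulation of the sphere $S^{d-1}$ on $N+1$ vertices, that is, a simplicial complex with exactly $N+1$ vertices whose geometric realization is homeomorphic to $S^{d-1}$. Then $$\chi\bigl(\mathrm{KG}^2(K,\Delta_N)\bigr) = N+1-d .$$ (2) Schrijver's theorem is the special case of even-dimensional cyclic polytopes. For $n\ge 1$ and $k\ge 0$ call a subset of $\{1,\dots,2n+k\}$ stable if it contains no two successive elements in the cyclic order (neither $i,i+1$ nor $2n+k,1$), and let $\mathrm{KG}'(n,2n+k)$ be the graph whose vertices are the stable $n$-element subsets of $\{1,\dots,2n+k\}$, with edges between disjoint ones. If $n\ge 2$ and $t_1<\dots<t_{2n+k}$ are real numbers, let $\partial C$ be the boundary complex of the cyclic polytope $C=\mathrm{conv}\{\gamma(t_1),\dots,\gamma(t_{2n+k})\}\subset\mathbb{R}^{2n-2}$,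 $\gamma(t)=(t,t^2,\dots,t^{2n-2})$, regarded as a simplicial complex on $\{1,\dots,2n+k\}$. Then $\partial C$ is a triangulation of $S^{2n-3}$ on $2n+k$ vertices and its missing faces are exactly the stable $n$-element subsets of $\{1,\dots,2n+k\}$, so that $\mathrm{KG}^2(\partial C,\Delta_{2n+k-1})=\mathrm{KG}'(n,2n+k)$. Moreover, for all $n\ge1$ and $k\ge0$, $$\chi\bigl(\mathrm{KG}'(n,2n+k)\bigr)=k+2 .$$ -/

import Mathlib

noncomputable section

namespace SphereKneser

/-- The geometric realization of a finite simplicial complex with vertices in `V`: the union, inside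
the standard simplex in `ℝ^V`, of the closed simplices spanned by the faces of `K`. It carries the
subspace topology of `V → ℝ`. -/
def realization {V : Type*} [Fintype V] (K : PreAbstractSimplicialComplex V) : Set (V → ℝ) :=
  {x | x ∈ stdSimplex ℝ V ∧ ∃ s ∈ K, ∀ v, x v ≠ 0 → v ∈ s}

/-- `K` is a triangulation of the sphere `S^{d-1}` (the unit sphere of `ℝ^d`) with vertex set
exactly `V`. -/
structure IsSphereTriangulation {V : Type*} [Fintype V] (K : PreAbstractSimplicialComplex V)
    (d : ℕ) : Prop where
  /-- every element of `V` is a vertex of `K` -/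
  singleton_mem : ∀ v : V, {v} ∈ K
  /-- the realization of `K` is homeomorphic to `S^{d-1}` -/
  homeomorphic : Nonempty (realization K ≃ₜ Metric.sphere (0 : EuclideanSpace ℝ (Fin d)) 1)

/-- The inclusion-minimal faces of `L` that are not faces of `K`. For `L = ⊤`, the full simplex on
`V`, these are the missing faces (minimal nonfaces) of `K`. -/
def missingFaces {V : Type*} (K L : PreAbstractSimplicialComplex V) : Set (Finset V) :=
  {s | Minimal (fun t => t ∈ L ∧ t ∉ K) s}

/-- The graph whose vertices are the members of a set system, two distinct members being adjacent
if and only if they are disjoint. -/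
def disjointnessGraph {V : Type*} (F : Set (Finset V)) : SimpleGraph F where
  Adj s t := s ≠ t ∧ Disjoint (s : Finset V) (t : Finset V)
  symm := ⟨fun _ _ h => ⟨h.1.symm, h.2.symm⟩⟩
  loopless := ⟨fun _ h => h.1 rfl⟩

/-- The generalized Kneser graph `KG²(K, L)`. -/
def kneserGraph {V : Type*} (K L : PreAbstractSimplicialComplex V) :
    SimpleGraph (missingFaces K L) :=
  disjointnessGraph (missingFaces K L)

/-- A set of elements of the cyclically ordered set `{0, …, m-1}` is stable if it does not contain
two cyclically successive elements. -/
def IsStable {m : ℕ} (s : Finset (Fin m)) : Prop :=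
  ∀ i ∈ s, ∀ j ∈ s, (j : ℕ) ≠ ((i : ℕ) + 1) % m

/-- The stable `n`-element subsets of an `m`-element cyclically ordered set. -/
def stableSets (n m : ℕ) : Set (Finset (Fin m)) :=
  {s | s.card = n ∧ IsStable s}

/-- The stable Kneser graph `KG'(n, m)`: the subgraph of the Kneser graph of `n`-element subsets
of an `m`-element set that is induced by the stable sets. -/
def stableKneserGraph (n m : ℕ) : SimpleGraph (stableSets n m) :=
  disjointnessGraph (stableSets n m)

/-- The moment curve `t ↦ (t, t², …, t^d)`. -/
def momentCurve (d : ℕ) (t : ℝ) : EuclideanSpace ℝ (Fin d) :=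
  WithLp.toLp 2 fun i => t ^ ((i : ℕ) + 1)

/-- The boundary complex of the polytope `P` spanned by the points `p i`: a nonempty set of indices
is a face if the corresponding points lie on a common proper face of `P`. When `P` is simplicial and
the `p i` are its distinct vertices (as for cyclic polytopes of dimension at least two), these are
precisely the vertex sets of the proper nonempty faces of `P`. -/
def boundaryComplex {ι E : Type*} [NormedAddCommGroup E] [NormedSpace ℝ E] (p : ι → E) :
    PreAbstractSimplicialComplex ι where
  faces := {s | s.Nonempty ∧ ∃ F : Set E, IsExposed ℝ (convexHull ℝ (Set.range p)) F ∧
    F ≠ convexHull ℝ (Set.range p) ∧ ∀ i ∈ s, p i ∈ F}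
  isRelLowerSet_faces := by
    rintro s ⟨hs, F, hF, hne, hsF⟩
    exact ⟨hs, fun t hts ht => ⟨ht, F, hF, hne, fun i hi => hsF i (hts hi)⟩⟩

/-- The boundary complex of the cyclic `d`-polytope with vertices at the parameters `t i` on the
moment curve. -/
def cyclicBoundary (d : ℕ) {m : ℕ} (t : Fin m → ℝ) : PreAbstractSimplicialComplex (Fin m) :=
  boundaryComplex fun i => momentCurve d (t i)

end SphereKneser

end

/-! Both bounds on the chromatic number use the cone over `K` inside ℝ^V. A homeomorphism from the
realization to the sphere extends radially to a continuous `Φ : ℝ^V → ℝ^d` that is injective on this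
cone (`exists_cone_map`).

Lower bound (`card_le_of_colorable`). Given `c` colours, let `P_i(z)` be the sum, over missing faces
of colour `i`, of the products of the positive parts of `z`. The map `z ↦ (P(z) - P(-z), Φ(z⁺) -
Φ(z⁻))` into ℝ^(c+d) is odd, so for `|V| > c + d` it has a zero `z ≠ 0`. If `P_i(z) = P_i(-z) > 0`,
there are two disjoint missing faces of the same colour. Hence neither `z⁺` nor `z⁻` has a missing
face in its support, both lie in the cone, and injectivity of `Φ` gives `z⁺ = z⁻`, that is `z = 0`.

Upper bound (`colorable_kneserGraph`). Every missing face has a vertex outside a given face `s`, and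
such a vertex serves as its colour. A face with at least `d` vertices exists because otherwise
finitely many C¹ images of spaces of dimension below `d` would cover ℝ^d (`exists_card_ge`).

Borsuk–Ulam is proved with mod 2 ordered chains. Chains `c_k` with `∂c_(k+1) = c_k + νc_k`, `ν`
being the antipode, detect the cup product of coboundaries of antipode-separating 0-cochains. For
the signs of the coordinates of an odd map this product is 1 on `c_m`, so some arbitrarily small
simplex sees every coordinate change sign, and the map cannot be bounded away from 0.

For cyclic polytopes, supporting hyperplanes are polynomials of degree at most `d` nonnegative at
the nodes. Gale's condition then follows from products of quadratics in one direction and from the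
Lagrange formula for a leading coefficient in the other (`notMem_cyclicBoundary_iff`). Schrijver's
theorem is the sphere formula with `d = 2n - 2`. -/

noncomputable section

namespace SphereKneser

/-! ### Ordered chains mod 2: boundary, cones, push-forward -/

section Chains

variable {E F : Type*}

/-- Augmented ordered chains with coefficients in `ℤ/2`: a list with `k + 1` entries is an ordered
`k`-simplex. -/
abbrev OrderedChain (E : Type*) := List E →₀ ZMod 2

/-- The boundary of an ordered simplex. -/
def listBoundary : List E → OrderedChain E
  | [] => 0
  | v :: l => Finsupp.single l 1 + Finsupp.lmapDomain (ZMod 2) (ZMod 2) (v :: ·) (listBoundary l)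

/-- The boundary operator of the augmented ordered chain complex. -/
def boundary : OrderedChain E →ₗ[ZMod 2] OrderedChain E :=
  Finsupp.linearCombination (ZMod 2) listBoundary

/-- The cone over an ordered chain with apex `v`. -/
def coneChain (v : E) : OrderedChain E →ₗ[ZMod 2] OrderedChain E :=
  Finsupp.lmapDomain (ZMod 2) (ZMod 2) (v :: ·)

/-- The push-forward of ordered chains along a map of vertices. -/
def mapChain (f : E → F) : OrderedChain E →ₗ[ZMod 2] OrderedChain F :=
  Finsupp.lmapDomain (ZMod 2) (ZMod 2) (List.map f)

/-- The chains all of whose simplices satisfy `P`. -/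
abbrev chainsOn (P : List E → Prop) : Submodule (ZMod 2) (OrderedChain E) :=
  Finsupp.supported (ZMod 2) (ZMod 2) {l | P l}

@[simp] lemma boundary_single (l : List E) (a : ZMod 2) :
    boundary (Finsupp.single l a) = a • listBoundary l := by
  simp [boundary]

@[simp] lemma coneChain_single (v : E) (l : List E) (a : ZMod 2) :
    coneChain v (Finsupp.single l a) = Finsupp.single (v :: l) a := by
  simp [coneChain]

@[simp] lemma mapChain_single (f : E → F) (l : List E) (a : ZMod 2) :
    mapChain f (Finsupp.single l a) = Finsupp.single (l.map f) a := by
  simp [mapChain]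

lemma listBoundary_cons (v : E) (l : List E) :
    listBoundary (v :: l) = Finsupp.single l 1 + coneChain v (listBoundary l) := rfl

lemma chain_add_self (c : OrderedChain E) : c + c = 0 := by
  ext l
  exact CharTwo.add_self_eq_zero _

/-- To prove an identity of linear maps on chains of simplices satisfying `P`, it suffices to check
it on those simplices. -/
lemma eq_of_eq_on_chainsOn {M : Type*} [AddCommMonoid M] [Module (ZMod 2) M] {P : List E → Prop}
    (f g : OrderedChain E →ₗ[ZMod 2] M) (h : ∀ l, P l → f (Finsupp.single l 1) = g (Finsupp.single l 1))
    {c : OrderedChain E} (hc : c ∈ chainsOn P) : f c = g c := by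
  have hc' := hc
  rw [chainsOn, Finsupp.supported_eq_span_single] at hc'
  induction hc' using Submodule.span_induction with
  | mem x hx => obtain ⟨l, hl, rfl⟩ := hx; exact h l hl
  | zero => simp
  | add x y hx hy h1 h2 =>
    rw [← Finsupp.supported_eq_span_single] at hx hy
    rw [map_add, map_add, h1 hx, h2 hy]
  | smul a x hx h1 =>
    rw [← Finsupp.supported_eq_span_single] at hx
    rw [map_smul, map_smul, h1 hx]

lemma map_mem_chainsOn {P : List E → Prop} {Q : List F → Prop}
    (f : OrderedChain E →ₗ[ZMod 2] OrderedChain F)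
    (h : ∀ l, P l → f (Finsupp.single l 1) ∈ chainsOn Q)
    {c : OrderedChain E} (hc : c ∈ chainsOn P) : f c ∈ chainsOn Q := by
  have hle : chainsOn P ≤ (chainsOn Q).comap f := by
    rw [chainsOn, Finsupp.supported_eq_span_single, Submodule.span_le]
    rintro _ ⟨l, hl, rfl⟩
    exact h l hl
  exact hle hc

lemma chainsOn_mono {P Q : List E → Prop} (h : ∀ l, P l → Q l) {c : OrderedChain E}
    (hc : c ∈ chainsOn P) : c ∈ chainsOn Q :=
  Finsupp.supported_mono (fun l hl => h l hl) hc

lemma single_mem_chainsOn {P : List E → Prop} {l : List E} (h : P l) :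
    Finsupp.single l (1 : ZMod 2) ∈ chainsOn P :=
  Finsupp.single_mem_supported _ _ h

lemma coneChain_mem {P Q : List E → Prop} {v : E} (h : ∀ l, P l → Q (v :: l))
    {c : OrderedChain E} (hc : c ∈ chainsOn P) : coneChain v c ∈ chainsOn Q :=
  map_mem_chainsOn _ (fun l hl => by
    rw [coneChain_single]; exact single_mem_chainsOn (h l hl)) hc

lemma mapChain_mem {P : List E → Prop} {Q : List F → Prop} {f : E → F} (h : ∀ l, P l → Q (l.map f))
    {c : OrderedChain E} (hc : c ∈ chainsOn P) : mapChain f c ∈ chainsOn Q :=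
  map_mem_chainsOn _ (fun l hl => by
    rw [mapChain_single]; exact single_mem_chainsOn (h l hl)) hc

lemma linearMap_ext_single {M : Type*} [AddCommMonoid M] [Module (ZMod 2) M]
    {f g : OrderedChain E →ₗ[ZMod 2] M}
    (h : ∀ l, f (Finsupp.single l 1) = g (Finsupp.single l 1)) (c : OrderedChain E) : f c = g c :=
  eq_of_eq_on_chainsOn (P := fun _ => True) f g (fun l _ => h l) (by simp [chainsOn])

/-- Deleting the apex returns `c`; deleting any other vertex commutes with coning. Augmentation
makes this correct on the empty simplex as well. -/
lemma boundary_coneChain (v : E) (c : OrderedChain E) :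
    boundary (coneChain v c) = c + coneChain v (boundary c) := by
  refine linearMap_ext_single (f := boundary ∘ₗ coneChain v)
    (g := LinearMap.id + coneChain v ∘ₗ boundary) (fun l => ?_) c
  simp [listBoundary_cons]

lemma boundary_listBoundary (l : List E) : boundary (listBoundary l) = 0 := by
  induction l with
  | nil => simp [listBoundary]
  | cons v l ih =>
    rw [listBoundary_cons, map_add, boundary_coneChain, ih, boundary_single, one_smul, map_zero,
      add_zero, chain_add_self]

lemma mapChain_coneChain (f : E → F) (v : E) (c : OrderedChain E) :
    mapChain f (coneChain v c) = coneChain (f v) (mapChain f c) :=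
  linearMap_ext_single (f := mapChain f ∘ₗ coneChain v) (g := coneChain (f v) ∘ₗ mapChain f)
    (fun l => by simp) c

lemma listBoundary_map (f : E → F) (l : List E) :
    listBoundary (l.map f) = mapChain f (listBoundary l) := by
  induction l with
  | nil => simp [listBoundary]
  | cons v l ih => simp [listBoundary_cons, ih, mapChain_coneChain]

lemma boundary_mapChain (f : E → F) (c : OrderedChain E) :
    boundary (mapChain f c) = mapChain f (boundary c) :=
  linearMap_ext_single (f := boundary ∘ₗ mapChain f) (g := mapChain f ∘ₗ boundary)
    (fun l => by simp [listBoundary_map]) c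

lemma listBoundary_mem (l : List E) :
    listBoundary l ∈ chainsOn fun l' => l'.Sublist l ∧ l'.length + 1 = l.length := by
  induction l with
  | nil => simp [listBoundary]
  | cons v l ih =>
    rw [listBoundary_cons]
    refine add_mem (single_mem_chainsOn ⟨List.sublist_cons_self v l, rfl⟩) (coneChain_mem ?_ ih)
    rintro l' ⟨h1, h2⟩
    exact ⟨h1.cons_cons v, by simpa using h2⟩

end Chains

/-! ### Cup products of coboundaries and their values on antipodal towers -/

section Cochains

variable {E : Type*}

/-- Evaluation of a cochain on a chain. -/
def evalChain (φ : List E → ZMod 2) : OrderedChain E →ₗ[ZMod 2] ZMod 2 :=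
  Finsupp.linearCombination (ZMod 2) φ

@[simp] lemma evalChain_single (φ : List E → ZMod 2) (l : List E) (a : ZMod 2) :
    evalChain φ (Finsupp.single l a) = a * φ l := by
  simp [evalChain]

lemma evalChain_coneChain (φ : List E → ZMod 2) (v : E) (c : OrderedChain E) :
    evalChain φ (coneChain v c) = evalChain (fun l => φ (v :: l)) c :=
  linearMap_ext_single (f := evalChain φ ∘ₗ coneChain v) (fun l => by simp) c

/-- The cup product of the coboundaries of the functions in a list. -/
def cupCoboundary : List (E → ZMod 2) → List E → ZMod 2
  | [], [_] => 1
  | f :: fs, x :: y :: l => (f x + f y) * cupCoboundary fs (y :: l)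
  | _, _ => 0

/-- The cup product of the first function of a list with the coboundaries of the others. -/
def cupPrimitive : List (E → ZMod 2) → List E → ZMod 2
  | f :: fs, x :: l => f x * cupCoboundary fs (x :: l)
  | _, _ => 0

/-- The cocycle condition on the simplex `x :: y :: l`, with the face omitting `x` moved to the
right-hand side. In this form the induction on `fs` closes. -/
lemma cupCoboundary_cocycle (fs : List (E → ZMod 2)) (x y : E) (l : List E) :
    evalChain (fun l' => cupCoboundary fs (x :: l')) (listBoundary (y :: l)) =
      cupCoboundary fs (y :: l) := by
  induction fs generalizing x y l with
  | nil =>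
    cases l with
    | nil => simp [listBoundary, cupCoboundary]
    | cons z l =>
      rw [listBoundary_cons, map_add, evalChain_coneChain]
      simp [cupCoboundary, evalChain, Finsupp.linearCombination_apply]
  | cons f fs ih =>
    cases l with
    | nil => simp [listBoundary, cupCoboundary]
    | cons z l =>
      rw [listBoundary_cons, map_add, evalChain_coneChain]
      have h : evalChain (fun l' => cupCoboundary (f :: fs) (x :: y :: l')) (listBoundary (z :: l)) =
          (f x + f y) * cupCoboundary fs (z :: l) := by
        rw [← ih y z l]
        simp [evalChain, Finsupp.linearCombination_apply, cupCoboundary, Finsupp.sum,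
          Finset.mul_sum, mul_left_comm]
      rw [h]
      simp only [evalChain_single, cupCoboundary]
      generalize cupCoboundary fs (z :: l) = w
      linear_combination (f x * w) * CharTwo.two_eq_zero (R := ZMod 2)

/-- The Leibniz rule `δ(f ∪ δf₂ ∪ …) = δf ∪ δf₂ ∪ …`, the remaining term vanishing by
`cupCoboundary_cocycle`. -/
lemma evalChain_cupPrimitive_listBoundary (f : E → ZMod 2) (fs : List (E → ZMod 2)) (x : E)
    (y : E) (l : List E) :
    evalChain (cupPrimitive (f :: fs)) (listBoundary (x :: y :: l)) =
      cupCoboundary (f :: fs) (x :: y :: l) := by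
  rw [listBoundary_cons, map_add, evalChain_coneChain]
  have h : evalChain (fun l' => cupPrimitive (f :: fs) (x :: l')) (listBoundary (y :: l)) =
      f x * cupCoboundary fs (y :: l) := by
    rw [← cupCoboundary_cocycle fs x y l]
    simp [evalChain, Finsupp.linearCombination_apply, cupPrimitive, Finsupp.sum,
      Finset.mul_sum, mul_left_comm]
  rw [h]
  simp only [evalChain_single, cupPrimitive, cupCoboundary]
  ring

/-- The antipode changes each function by the constant 1, which its coboundary does not see. -/
lemma cupCoboundary_map_neg [Neg E] {fs : List (E → ZMod 2)} {l : List E}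
    (h : ∀ f ∈ fs, ∀ v ∈ l, f v + f (-v) = 1) :
    cupCoboundary fs (l.map (- ·)) = cupCoboundary fs l := by
  induction fs generalizing l with
  | nil =>
    match l with
    | [] => rfl
    | [x] => rfl
    | x :: y :: l => rfl
  | cons f fs ih =>
    match l with
    | [] => rfl
    | [x] => rfl
    | x :: y :: l =>
      have := ih (l := y :: l) fun g hg v hv =>
        h g (List.mem_cons_of_mem _ hg) v (List.mem_cons_of_mem _ hv)
      simp only [List.map_cons] at this
      simp only [List.map_cons, cupCoboundary, this]
      congr 1
      have h1 := h f (by simp) x (by simp)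
      have h2 := h f (by simp) y (by simp)
      linear_combination h1 + h2 + (1 - f x - f y) * CharTwo.two_eq_zero (R := ZMod 2)

/-- A tower of chains relating the simplices of antipodal spheres detects the cup product of
coboundaries of functions that separate antipodes. -/
lemma evalChain_cupCoboundary_eq_one [Neg E] (m : ℕ) (c : ℕ → OrderedChain E) (V : Set E)
    (hc : ∀ k ≤ m, c k ∈ chainsOn fun l => l.length = k + 1 ∧ ∀ v ∈ l, v ∈ V)
    (h0 : boundary (c 0) = Finsupp.single [] 1)
    (hs : ∀ k < m, boundary (c (k + 1)) = c k + mapChain (- ·) (c k))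
    (fs : List (E → ZMod 2)) (hfs : ∀ f ∈ fs, ∀ v ∈ V, f v + f (-v) = 1) (hm : fs.length ≤ m) :
    evalChain (cupCoboundary fs) (c fs.length) = 1 := by
  induction fs with
  | nil =>
    have h : evalChain (cupCoboundary []) (c 0) =
        evalChain (fun l => if l = [] then 1 else 0) (boundary (c 0)) := by
      refine eq_of_eq_on_chainsOn _ (evalChain _ ∘ₗ boundary) (fun l hl => ?_) (hc 0 hm)
      obtain ⟨x, rfl⟩ := List.length_eq_one_iff.1 hl.1
      simp [cupCoboundary, listBoundary]
    rw [List.length_nil, h, h0]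
    simp
  | cons f fs ih =>
    simp only [List.length_cons] at hm ⊢
    -- Stokes: the product is a coboundary, so it may be evaluated on the boundary of the chain.
    have h1 : evalChain (cupCoboundary (f :: fs)) (c (fs.length + 1)) =
        evalChain (cupPrimitive (f :: fs)) (boundary (c (fs.length + 1))) := by
      refine eq_of_eq_on_chainsOn _ (evalChain _ ∘ₗ boundary) (fun l hl => ?_) (hc _ hm)
      match l, hl with
      | x :: y :: l, _ =>
        simp [evalChain_cupPrimitive_listBoundary]
    -- The factors from `fs` agree on a simplex and its antipode, while the values of `f` add up to
    -- 1; only the product over `fs` survives.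
    have h2 : evalChain (cupPrimitive (f :: fs)) (c fs.length + mapChain (- ·) (c fs.length)) =
        evalChain (cupCoboundary fs) (c fs.length) := by
      refine eq_of_eq_on_chainsOn (evalChain _ ∘ₗ (LinearMap.id + mapChain (- ·))) _
        (fun l hl => ?_) (hc fs.length (by omega))
      match l, hl with
      | x :: l, hl =>
        have h3 := cupCoboundary_map_neg (fs := fs) (l := x :: l) fun g hg v hv =>
          hfs g (List.mem_cons_of_mem _ hg) v (hl.2 v hv)
        have h4 := hfs f (by simp) x (hl.2 x (by simp))
        simp only [List.map_cons] at h3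
        simp [cupPrimitive, h3, ← add_mul, h4]
    rw [h1, hs _ (by omega), h2]
    exact ih (fun g hg => hfs g (List.mem_cons_of_mem _ hg)) (by omega)

end Cochains

/-! ### Barycentric subdivision and its effect on diameters -/

section Subdivision

variable {E : Type*} [NormedAddCommGroup E] [NormedSpace ℝ E]

/-- The barycenter of the entries of a list. -/
def barycenter (l : List E) : E := (l.length : ℝ)⁻¹ • l.sum

/-- Barycentric subdivision of chains of simplices with `n` vertices. -/
def subdivide : ℕ → OrderedChain E →ₗ[ZMod 2] OrderedChain E
  | 0 => LinearMap.id
  | n + 1 => Finsupp.linearCombination (ZMod 2) fun l =>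
      coneChain (barycenter l) (subdivide n (listBoundary l))

lemma subdivide_succ_single (n : ℕ) (l : List E) :
    subdivide (n + 1) (Finsupp.single l 1) =
      coneChain (barycenter l) (subdivide n (listBoundary l)) := by
  simp [subdivide]

@[simp] lemma subdivide_zero (c : OrderedChain E) : subdivide 0 c = c := rfl

attribute [irreducible] subdivide

/-- By induction the subdivided boundary of a simplex is a cycle, so the boundary of its cone is
that cycle. The index of `subdivide` counts vertices, hence drops by one. -/
lemma boundary_subdivide (n : ℕ) {c : OrderedChain E}
    (hc : c ∈ chainsOn fun l => l.length = n + 1) :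
    boundary (subdivide (n + 1) c) = subdivide n (boundary c) := by
  induction n generalizing c with
  | zero =>
    refine eq_of_eq_on_chainsOn (boundary ∘ₗ subdivide (0 + 1)) (subdivide 0 ∘ₗ boundary)
      (fun l hl => ?_) hc
    obtain ⟨x, rfl⟩ := List.length_eq_one_iff.1 hl
    simp only [LinearMap.comp_apply, subdivide_succ_single]
    simp [listBoundary]
  | succ n ih =>
    rw [← LinearMap.comp_apply, ← LinearMap.comp_apply]
    refine eq_of_eq_on_chainsOn (boundary ∘ₗ subdivide (n + 1 + 1)) (subdivide (n + 1) ∘ₗ boundary)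
      (fun l hl => ?_) hc
    have hmem : listBoundary l ∈ chainsOn fun l' => l'.length = n + 1 :=
      chainsOn_mono (fun l' h => by have := h.2; omega) (listBoundary_mem l)
    have h : boundary (subdivide (n + 1) (listBoundary l)) = 0 := by
      rw [ih hmem, boundary_listBoundary, map_zero]
    simp only [LinearMap.comp_apply, subdivide_succ_single, boundary_coneChain, h, boundary_single,
      one_smul, map_zero, add_zero]

lemma barycenter_map_neg (l : List E) : barycenter (l.map (- ·)) = -barycenter l := by
  have : (l.map (- ·)).sum = -l.sum := by
    induction l with
    | nil => simp
    | cons a l ih => simp [ih, add_comm]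
  simp [barycenter, this]

lemma subdivide_map_neg (n : ℕ) (c : OrderedChain E) :
    subdivide n (mapChain (- ·) c) = mapChain (- ·) (subdivide n c) := by
  induction n generalizing c with
  | zero => simp
  | succ n ih =>
    refine linearMap_ext_single (f := subdivide (n + 1) ∘ₗ mapChain (- ·))
      (g := mapChain (- ·) ∘ₗ subdivide (n + 1)) (fun l => ?_) c
    simp only [LinearMap.comp_apply, mapChain_single, subdivide_succ_single, listBoundary_map, ih,
      barycenter_map_neg, mapChain_coneChain]

lemma sum_eq_sum_get {E : Type*} [AddCommMonoid E] (l : List E) : l.sum = ∑ i, l.get i := by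
  conv_lhs => rw [← List.ofFn_get l, List.sum_ofFn]

lemma barycenter_mem_convexHull {l : List E} (hl : l ≠ []) :
    barycenter l ∈ convexHull ℝ {v | v ∈ l} := by
  have hn : (l.length : ℝ) ≠ 0 := by simpa using hl
  have : barycenter l = ∑ i : Fin l.length, (l.length : ℝ)⁻¹ • l.get i := by
    rw [barycenter, ← Finset.smul_sum, sum_eq_sum_get]
  rw [this]
  refine (convex_convexHull ℝ _).sum_mem (fun _ _ => by positivity) ?_ fun i _ => ?_
  · simp [hn]
  · exact subset_convexHull ℝ _ (List.get_mem l i)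

/-- The difference is the average of the vectors from `w` to the entries, one of which is zero; this
gives the factor `(length - 1) / length`, which increases with the length. -/
lemma dist_barycenter_le {M : ℕ} {l : List E} {r : ℝ} (hr : 0 ≤ r) (hM : l.length ≤ M + 1)
    (hl : ∀ v ∈ l, ∀ w ∈ l, dist v w ≤ r) {w : E} (hw : w ∈ l) :
    dist (barycenter l) w ≤ M / (M + 1) * r := by
  obtain ⟨j, rfl⟩ := List.mem_iff_get.1 hw
  have hpos : 0 < l.length := List.length_pos_of_mem hw
  have hn : (l.length : ℝ) ≠ 0 := by positivity
  have h1 : barycenter l - l.get j =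
      (l.length : ℝ)⁻¹ • ∑ i ∈ Finset.univ.erase j, (l.get i - l.get j) := by
    have h2 : ∑ i ∈ Finset.univ.erase j, (l.get i - l.get j) = ∑ i, (l.get i - l.get j) := by
      rw [← Finset.add_sum_erase _ _ (Finset.mem_univ j), sub_self, zero_add]
    rw [h2, Finset.sum_sub_distrib, smul_sub, barycenter, sum_eq_sum_get]
    simp [← Nat.cast_smul_eq_nsmul ℝ, smul_smul, hn]
  rw [dist_eq_norm, h1, norm_smul]
  have h3 : ‖∑ i ∈ Finset.univ.erase j, (l.get i - l.get j)‖ ≤ (l.length - 1) * r := by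
    refine (norm_sum_le_of_le _ fun i _ => (dist_eq_norm (l.get i) (l.get j)).symm.trans_le
      (hl _ (List.get_mem _ _) _ (List.get_mem _ _))).trans ?_
    rw [Finset.sum_const, Finset.card_erase_of_mem (Finset.mem_univ _), Finset.card_univ,
      Fintype.card_fin, nsmul_eq_mul, Nat.cast_sub (by omega), Nat.cast_one]
  have hM' : (l.length : ℝ) ≤ M + 1 := by exact_mod_cast hM
  calc ‖(l.length : ℝ)⁻¹‖ * ‖∑ i ∈ Finset.univ.erase j, (l.get i - l.get j)‖
      ≤ (l.length : ℝ)⁻¹ * ((l.length - 1) * r) := by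
        rw [norm_inv, Real.norm_natCast]; gcongr
    _ = ((l.length - 1) / l.length) * r := by ring
    _ ≤ M / (M + 1) * r := by
        refine mul_le_mul_of_nonneg_right ?_ hr
        rw [div_le_div_iff₀ (by positivity) (by positivity)]
        nlinarith

/-- A list with `n` entries in `S` at mutual distances at most `r`. -/
def IsSmallSimplex (n : ℕ) (S : Set E) (r : ℝ) (l : List E) : Prop :=
  l.length = n ∧ (∀ v ∈ l, v ∈ S) ∧ ∀ v ∈ l, ∀ w ∈ l, dist v w ≤ r

lemma subdivide_mem {M : ℕ} {S : Set E} (hS : Convex ℝ S) {r : ℝ} (hr : 0 ≤ r) {n : ℕ}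
    (hn : n ≤ M + 1) {c : OrderedChain E} (hc : c ∈ chainsOn (IsSmallSimplex n S r)) :
    subdivide n c ∈ chainsOn (IsSmallSimplex n S (M / (M + 1) * r)) := by
  induction n generalizing S c with
  | zero =>
    rw [subdivide_zero]
    refine chainsOn_mono (fun l hl => ?_) hc
    have : l = [] := List.length_eq_zero_iff.1 hl.1
    subst this
    simp [IsSmallSimplex]
  | succ n ih =>
    refine map_mem_chainsOn _ (fun l hl => ?_) hc
    rw [subdivide_succ_single]
    have hne : l ≠ [] := by rintro rfl; simp [IsSmallSimplex] at hl
    have hsub : convexHull ℝ {v | v ∈ l} ⊆ S := convexHull_min hl.2.1 hS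
    refine coneChain_mem (P := IsSmallSimplex n (convexHull ℝ {v | v ∈ l}) (M / (M + 1) * r)) ?_
      (ih (convex_convexHull ℝ _) (by omega) (chainsOn_mono ?_ (listBoundary_mem l)))
    · rintro l' ⟨h1, h2, h3⟩
      -- A ball around the barycenter containing all vertices contains their hull, hence every
      -- vertex of the subdivided boundary.
      have hb : ∀ w ∈ l', dist w (barycenter l) ≤ M / (M + 1) * r := fun w hw =>
        (convexHull_min (t := Metric.closedBall (barycenter l) (M / (M + 1) * r))
          (fun v hv => by
            rw [Metric.mem_closedBall, dist_comm]
            exact dist_barycenter_le hr (hl.1.trans_le hn) hl.2.2 hv)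
          (convex_closedBall _ _)) (h2 w hw)
      refine ⟨by simp [h1], ?_, ?_⟩
      · simp only [List.mem_cons, forall_eq_or_imp]
        exact ⟨hsub (barycenter_mem_convexHull hne), fun v hv => hsub (h2 v hv)⟩
      · simp only [List.mem_cons, forall_eq_or_imp]
        refine ⟨⟨by rw [dist_self]; positivity, fun w hw => ?_⟩, fun v hv => ⟨hb v hv, h3 v hv⟩⟩
        rw [dist_comm]
        exact hb w hw
    · rintro l' ⟨h1, h2⟩
      exact ⟨by have := hl.1; omega, fun v hv => subset_convexHull ℝ _ (h1.subset hv),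
        fun v hv w hw => hl.2.2 v (h1.subset hv) w (h1.subset hw)⟩

/-- A simplex with `n` vertices lying in a convex set from the family `𝒮`. -/
def IsSmallSimplexIn (n : ℕ) (𝒮 : Set (Set E)) (r : ℝ) (l : List E) : Prop :=
  ∃ S ∈ 𝒮, IsSmallSimplex n S r l

lemma subdivide_mem_family {M : ℕ} {𝒮 : Set (Set E)} (h𝒮 : ∀ S ∈ 𝒮, Convex ℝ S) {r : ℝ}
    (hr : 0 ≤ r) {n : ℕ} (hn : n ≤ M + 1) {c : OrderedChain E}
    (hc : c ∈ chainsOn (IsSmallSimplexIn n 𝒮 r)) :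
    subdivide n c ∈ chainsOn (IsSmallSimplexIn n 𝒮 (M / (M + 1) * r)) := by
  refine map_mem_chainsOn _ (fun l hl => ?_) hc
  obtain ⟨S, hS, hl⟩ := hl
  exact chainsOn_mono (fun l' hl' => ⟨S, hS, hl'⟩)
    (subdivide_mem (h𝒮 S hS) hr hn (single_mem_chainsOn hl))

end Subdivision

/-! ### Refinable antipodal towers, octahedral chains and sign cochains -/

section BorsukUlam

/-- A tower of chains relating the simplices of antipodal spheres can be refined. -/
lemma exists_small_tower {E : Type*} [NormedAddCommGroup E] [NormedSpace ℝ E] (m : ℕ)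
    {𝒮 : Set (Set E)} (h𝒮 : ∀ S ∈ 𝒮, Convex ℝ S) {r : ℝ} (hr : 0 ≤ r) (c : ℕ → OrderedChain E)
    (hc : ∀ k ≤ m, c k ∈ chainsOn (IsSmallSimplexIn (k + 1) 𝒮 r))
    (h0 : boundary (c 0) = Finsupp.single [] 1)
    (hs : ∀ k < m, boundary (c (k + 1)) = c k + mapChain (- ·) (c k)) {ε : ℝ} (hε : 0 < ε) :
    ∃ c' : ℕ → OrderedChain E, (∀ k ≤ m, c' k ∈ chainsOn (IsSmallSimplexIn (k + 1) 𝒮 ε)) ∧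
      boundary (c' 0) = Finsupp.single [] 1 ∧
      ∀ k < m, boundary (c' (k + 1)) = c' k + mapChain (- ·) (c' k) := by
  have step : ∀ j : ℕ, ∃ c' : ℕ → OrderedChain E,
      (∀ k ≤ m, c' k ∈ chainsOn (IsSmallSimplexIn (k + 1) 𝒮 ((m / (m + 1) : ℝ) ^ j * r))) ∧
      boundary (c' 0) = Finsupp.single [] 1 ∧
      ∀ k < m, boundary (c' (k + 1)) = c' k + mapChain (- ·) (c' k) := by
    intro j
    induction j with
    | zero => exact ⟨c, by simpa using hc, h0, hs⟩
    | succ j ih =>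
      obtain ⟨c', h1, h2, h3⟩ := ih
      have hlen : ∀ k ≤ m, c' k ∈ chainsOn fun l => l.length = k + 1 := fun k hk =>
        chainsOn_mono (fun l ⟨_, _, h⟩ => h.1) (h1 k hk)
      refine ⟨fun k => subdivide (k + 1) (c' k), fun k hk => ?_, ?_, fun k hk => ?_⟩
      · rw [pow_succ', mul_assoc]
        exact subdivide_mem_family h𝒮 (by positivity) (by omega) (h1 k hk)
      · rw [boundary_subdivide 0 (hlen 0 (by omega)), h2]
        exact subdivide_zero _
      · rw [boundary_subdivide (k + 1) (hlen (k + 1) hk), h3 k hk, map_add, subdivide_map_neg]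
  have hlim : Filter.Tendsto (fun j : ℕ => (m / (m + 1) : ℝ) ^ j * r) Filter.atTop (nhds (0 * r)) :=
    (tendsto_pow_atTop_nhds_zero_of_lt_one (by positivity)
      ((div_lt_one (by positivity)).2 (by linarith))).mul_const r
  rw [zero_mul] at hlim
  obtain ⟨j, hj⟩ := (hlim.eventually_lt_const hε).exists
  obtain ⟨c', h1, h2, h3⟩ := step j
  refine ⟨c', fun k hk => chainsOn_mono ?_ (h1 k hk), h2, h3⟩
  rintro l ⟨S, hS, h, h', h''⟩
  exact ⟨S, hS, h, h', fun v hv w hw => (h'' v hv w hw).trans hj.le⟩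

/-- The chains of the standard triangulation of the sphere by the boundary of the crosspolytope
spanned by `e 0, e 1, …`. -/
def octahedralChain {E : Type*} [Neg E] (e : ℕ → E) : ℕ → OrderedChain E
  | 0 => Finsupp.single [e 0] 1
  | k + 1 => coneChain (e (k + 1)) (octahedralChain e k + mapChain (- ·) (octahedralChain e k))

lemma mapChain_neg_neg {E : Type*} [InvolutiveNeg E] (c : OrderedChain E) :
    mapChain (- ·) (mapChain (- ·) c) = c :=
  linearMap_ext_single (f := mapChain (- ·) ∘ₗ mapChain (- ·)) (g := LinearMap.id)
    (fun l => by simp) c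

lemma boundary_octahedralChain_zero {E : Type*} [Neg E] (e : ℕ → E) :
    boundary (octahedralChain e 0) = Finsupp.single [] 1 := by
  simp [octahedralChain, listBoundary]

/-- The two hemispheres `c_k` and its antipode form a cycle, and `c_(k+1)` is the cone over it. -/
lemma boundary_octahedralChain_succ {E : Type*} [InvolutiveNeg E] (e : ℕ → E) (k : ℕ) :
    boundary (octahedralChain e (k + 1)) =
      octahedralChain e k + mapChain (- ·) (octahedralChain e k) := by
  have hz : boundary (octahedralChain e k + mapChain (- ·) (octahedralChain e k)) = 0 := by
    induction k with
    | zero =>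
      rw [map_add, boundary_mapChain, boundary_octahedralChain_zero, mapChain_single]
      exact chain_add_self _
    | succ k ih =>
      rw [map_add, boundary_mapChain]
      rw [octahedralChain, boundary_coneChain, ih, map_zero, add_zero, map_add, mapChain_neg_neg,
        add_comm (mapChain _ _), chain_add_self]
  rw [octahedralChain, boundary_coneChain, hz, map_zero, add_zero]

/-- A function with values in `ℤ/2` that separates antipodes and records the sign of `g`. -/
def signBit {E : Type*} [Neg E] (g : E → ℝ) (v : E) : ZMod 2 :=
  open Classical in if 0 < g v ∨ g v = 0 ∧ WellOrderingRel v (-v) then 1 else 0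

/-- Where `g` vanishes, the well-ordering selects exactly one of `v` and `-v`. -/
lemma signBit_add_neg {E : Type*} [InvolutiveNeg E] {g : E → ℝ} {v : E}
    (hg : g (-v) = -g v) (hv : v ≠ -v) : signBit g v + signBit g (-v) = 1 := by
  have h1 : ¬ (WellOrderingRel v (-v) ∧ WellOrderingRel (-v) v) := fun h =>
    asymm_of WellOrderingRel h.1 h.2
  have h2 : WellOrderingRel v (-v) ∨ WellOrderingRel (-v) v := by
    rcases trichotomous_of WellOrderingRel v (-v) with h | h | h
    · exact Or.inl h
    · exact absurd h hv
    · exact Or.inr h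
  unfold signBit
  rw [hg, neg_neg]
  rcases lt_trichotomy (g v) 0 with h | h | h
  · simp [h, h.not_gt, h.ne]
  · by_cases h3 : WellOrderingRel v (-v)
    · have h4 : ¬ WellOrderingRel (-v) v := fun h4 => h1 ⟨h3, h4⟩
      simp [h, h3, h4]
    · have h4 := h2.resolve_left h3
      simp [h, h3, h4]
  · simp [h, h.not_gt, h.ne']

lemma abs_le_of_signBit_ne {E : Type*} [Neg E] {g : E → ℝ} {v w : E}
    (h : signBit g v ≠ signBit g w) : |g v| ≤ |g v - g w| := by
  unfold signBit at h
  rcases lt_trichotomy (g v) 0 with h1 | h1 | h1 <;> rcases lt_trichotomy (g w) 0 with h2 | h2 | h2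
  · simp [h1.ne, h2.ne, h1.not_gt, h2.not_gt] at h
  · simp [h2]
  · rw [abs_of_neg h1, abs_of_neg (by linarith)]; linarith
  · simp [h1]
  · simp [h1]
  · simp [h1]
  · rw [abs_of_pos h1, abs_of_pos (by linarith)]; linarith
  · simp [h2]
  · simp [h1, h2] at h

lemma exists_of_cupCoboundary_ne_zero {E : Type*} {fs : List (E → ZMod 2)} {l : List E}
    (h : cupCoboundary fs l ≠ 0) :
    ∀ f ∈ fs, ∃ v ∈ l, ∃ w ∈ l, f v ≠ f w := by
  induction fs generalizing l with
  | nil => simp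
  | cons f fs ih =>
    match l with
    | [] => simp [cupCoboundary] at h
    | [x] => simp [cupCoboundary] at h
    | x :: y :: l =>
      rw [cupCoboundary] at h
      intro g hg
      rcases List.mem_cons.1 hg with rfl | hg
      · refine ⟨x, by simp, y, by simp, fun hxy => left_ne_zero_of_mul h ?_⟩
        rw [hxy]; exact CharTwo.add_self_eq_zero _
      · obtain ⟨v, hv, w, hw, hvw⟩ := ih (right_ne_zero_of_mul h) g hg
        exact ⟨v, List.mem_cons_of_mem _ hv, w, List.mem_cons_of_mem _ hw, hvw⟩

end BorsukUlam

/-! ### The Borsuk–Ulam theorem and maps at bounded distance from the identity -/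

section BorsukUlam

/-- The functional `f` keeps the convex hull of each simplex away from the origin; the vanishing
coordinates leave room to extend `f` to the next apex. -/
lemma octahedralChain_mem {n : ℕ} {k : ℕ} (hk : k ≤ n) :
    octahedralChain (fun j => (fun i : Fin (n + 1) => if (i : ℕ) = j then (1 : ℝ) else 0)) k ∈
      chainsOn fun l => l.length = k + 1 ∧
        (∀ v ∈ l, ‖v‖ ≤ 1 ∧ ∀ i : Fin (n + 1), k < (i : ℕ) → v i = 0) ∧
        ∃ f : (Fin (n + 1) → ℝ) →ₗ[ℝ] ℝ, ∀ v ∈ l, 1 ≤ f v := by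
  have hnorm : ∀ j : ℕ, ‖(fun i : Fin (n + 1) => if (i : ℕ) = j then (1 : ℝ) else 0)‖ ≤ 1 :=
    fun j => (pi_norm_le_iff_of_nonneg zero_le_one).2 fun i => by
      split_ifs <;> simp
  induction k with
  | zero =>
    refine single_mem_chainsOn ⟨rfl, ?_, LinearMap.proj 0, ?_⟩
    · intro v hv
      rw [List.mem_singleton.1 hv]
      exact ⟨hnorm 0, fun i hi => if_neg hi.ne'⟩
    · intro v hv
      rw [List.mem_singleton.1 hv]
      simp
  | succ k ih =>
    have ih' := ih (by omega)
    refine coneChain_mem ?_ (add_mem ih' (mapChain_mem ?_ ih'))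
    · rintro l ⟨h1, h2, f, hf⟩
      set e : Fin (n + 1) → ℝ := fun i => if (i : ℕ) = k + 1 then 1 else 0 with he
      -- The correction makes the value at the new apex 1 and is invisible on the old vertices.
      let f' : (Fin (n + 1) → ℝ) →ₗ[ℝ] ℝ :=
        f + (1 - f e) • LinearMap.proj (⟨k + 1, by omega⟩ : Fin (n + 1))
      refine ⟨by simp [h1], ?_, f', ?_⟩
      · simp only [List.mem_cons, forall_eq_or_imp]
        exact ⟨⟨hnorm _, fun i hi => if_neg hi.ne'⟩,
          fun v hv => ⟨(h2 v hv).1, fun i hi => (h2 v hv).2 i (by omega)⟩⟩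
      · simp only [List.mem_cons, forall_eq_or_imp]
        refine ⟨by simp [f', he], fun v hv => ?_⟩
        have : v ⟨k + 1, by omega⟩ = 0 := (h2 v hv).2 _ (by simp)
        simpa [f', this] using hf v hv
    · rintro l ⟨h1, h2, f, hf⟩
      refine ⟨by simp [h1], ?_, -f, ?_⟩
      · simp only [List.mem_map, forall_exists_index, and_imp, forall_apply_eq_imp_iff₂]
        exact fun v hv => ⟨by simpa using (h2 v hv).1, fun i hi => by simp [(h2 v hv).2 i hi]⟩
      · simp only [List.mem_map, forall_exists_index, and_imp, forall_apply_eq_imp_iff₂]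
        exact fun v hv => by simpa using hf v hv

/-- **Borsuk–Ulam theorem**: an odd continuous map from `ℝ^(n+1) ∖ {0}` to `ℝ^m`, `m ≤ n`, has a
zero. -/
theorem borsukUlam {m n : ℕ} (hmn : m ≤ n) (H : (Fin (n + 1) → ℝ) → Fin m → ℝ)
    (hH : ContinuousOn H {0}ᶜ) (hodd : ∀ x, x ≠ 0 → H (-x) = -H x) : ∃ x, x ≠ 0 ∧ H x = 0 := by
  classical
  by_contra! hne
  set c := octahedralChain (fun j => (fun i : Fin (n + 1) => if (i : ℕ) = j then (1 : ℝ) else 0))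
    with hcdef
  set I : Finset (List (Fin (n + 1) → ℝ)) := (Finset.range (m + 1)).biUnion fun k => (c k).support
    with hI
  have hmem : ∀ k ≤ m, ∀ l ∈ (c k).support, l.length = k + 1 ∧
        (∀ v ∈ l, ‖v‖ ≤ 1 ∧ ∀ i : Fin (n + 1), k < (i : ℕ) → v i = 0) ∧
        ∃ f : (Fin (n + 1) → ℝ) →ₗ[ℝ] ℝ, ∀ v ∈ l, 1 ≤ f v := fun k hk l hl =>
    octahedralChain_mem (hk.trans hmn) hl
  have hImem : ∀ k ≤ m, ∀ l ∈ (c k).support, l ∈ I := fun k hk l hl =>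
    Finset.mem_biUnion.2 ⟨k, Finset.mem_range.2 (by omega), hl⟩
  let hull : List (Fin (n + 1) → ℝ) → Set (Fin (n + 1) → ℝ) := fun l => convexHull ℝ {v | v ∈ l}
  set K : Set (Fin (n + 1) → ℝ) := ⋃ l ∈ I, hull l with hK
  have hKc : IsCompact K := I.finite_toSet.isCompact_biUnion fun l _ =>
    (List.finite_toSet l).isCompact_convexHull ℝ
  have hK0 : ∀ v ∈ K, v ≠ 0 := by
    intro v hv
    simp only [hK, Set.mem_iUnion] at hv
    obtain ⟨l, hl, hv⟩ := hv
    obtain ⟨k, hk, hl⟩ := Finset.mem_biUnion.1 hl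
    obtain ⟨-, -, f, hf⟩ := hmem k (by simpa [Nat.lt_succ_iff] using hk) l hl
    have : (1 : ℝ) ≤ f v := convexHull_min (t := {v | 1 ≤ f v}) hf
      (convex_halfSpace_ge f.isLinear 1) hv
    rintro rfl
    simp at this
    linarith
  have hHK : ContinuousOn H K := hH.mono hK0
  -- `δ` bounds `‖H‖` from below on the compact set `K`, and points of `K` within `ε` have images
  -- within `δ / 2`.
  obtain ⟨δ, hδ, hδK⟩ := hKc.exists_forall_le' (f := fun v => ‖H v‖) (a := 0) hHK.norm
    fun v hv => norm_pos_iff.2 (hne v (hK0 v hv))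
  obtain ⟨ε, hε, hεK⟩ := Metric.uniformContinuousOn_iff.1
    (hKc.uniformContinuousOn_of_continuous hHK) (δ / 2) (by positivity)
  obtain ⟨c', hc', h0, hs⟩ := exists_small_tower m (𝒮 := {S | ∃ l ∈ I, S = hull l}) (r := 2)
    (by rintro S ⟨l, -, rfl⟩; exact convex_convexHull ℝ _) (by norm_num) c
    (fun k hk l hl => by
      obtain ⟨h1, h2, -⟩ := hmem k hk l hl
      refine ⟨hull l, ⟨l, hImem k hk l hl, rfl⟩, h1, fun v hv => subset_convexHull ℝ _ hv,
        fun v hv w hw => ?_⟩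
      rw [dist_eq_norm]
      linarith [norm_sub_le v w, (h2 v hv).1, (h2 w hw).1])
    (boundary_octahedralChain_zero _) (fun k _ => boundary_octahedralChain_succ _ k)
    (half_pos hε)
  let fs : List ((Fin (n + 1) → ℝ) → ZMod 2) := List.ofFn fun i : Fin m => signBit fun v => H v i
  have hlen : fs.length = m := List.length_ofFn
  have hSK : ∀ l ∈ I, hull l ⊆ K := fun l hl => Set.subset_biUnion_of_mem (u := hull) hl
  have h1 : evalChain (cupCoboundary fs) (c' fs.length) = 1 := by
    refine evalChain_cupCoboundary_eq_one m c' K (fun k hk => chainsOn_mono ?_ (hc' k hk)) h0 hs fs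
      ?_ hlen.le
    · rintro l ⟨_, ⟨l', hl', rfl⟩, h1, h2, -⟩
      exact ⟨h1, fun v hv => hSK l' hl' (h2 v hv)⟩
    · intro f hf v hv
      obtain ⟨i, rfl⟩ := (List.mem_ofFn' _ _).1 hf
      refine signBit_add_neg ?_ ?_
      · simp [hodd v (hK0 v hv)]
      · intro h
        exact hK0 v hv (self_eq_neg.1 h)
  -- A simplex with nonzero product has a sign change in every coordinate of `H`. Each coordinate is
  -- then below `δ / 2` at some vertex and below `δ` at `u`, contradicting the choice of `δ`.
  have h2 : evalChain (cupCoboundary fs) (c' m) = (0 : OrderedChain _ →ₗ[ZMod 2] ZMod 2) (c' m) := by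
    refine eq_of_eq_on_chainsOn _ _ (fun l hl => ?_) (hc' m le_rfl)
    obtain ⟨_, ⟨l', hl', rfl⟩, h1, h2, h3⟩ := hl
    rw [evalChain_single, one_mul, LinearMap.zero_apply]
    by_contra hcup
    obtain ⟨u, hu⟩ : ∃ u, u ∈ l := List.exists_mem_of_length_pos (by omega)
    have hlK : ∀ v ∈ l, v ∈ K := fun v hv => hSK l' hl' (h2 v hv)
    have hclose : ∀ v ∈ l, ∀ w ∈ l, ∀ i, |H v i - H w i| < δ / 2 := fun v hv w hw i =>
      (dist_le_pi_dist (H v) (H w) i).trans_lt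
        (hεK v (hlK v hv) w (hlK w hw) ((h3 v hv w hw).trans_lt (by linarith)))
    refine (hδK u (hlK u hu)).not_gt ((pi_norm_lt_iff hδ).2 fun i => ?_)
    obtain ⟨v, hv, w, hw, hvw⟩ := exists_of_cupCoboundary_ne_zero hcup
      (signBit fun v => H v i) ((List.mem_ofFn' _ _).2 ⟨i, rfl⟩)
    have h4 := abs_le_of_signBit_ne hvw
    have h5 := hclose v hv w hw i
    have h6 := hclose u hu v hv i
    have h7 := abs_sub_abs_le_abs_sub (H u i) (H v i)
    rw [Real.norm_eq_abs]
    linarith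
  rw [hlen, h2] at h1
  simp at h1

/-- Version of `borsukUlam` for functions on and to finite-dimensional spaces. -/
theorem borsukUlam_of_finrank_lt {E F : Type*} [NormedAddCommGroup E] [NormedSpace ℝ E]
    [FiniteDimensional ℝ E] [NormedAddCommGroup F] [NormedSpace ℝ F] [FiniteDimensional ℝ F]
    (hEF : Module.finrank ℝ F < Module.finrank ℝ E) (H : E → F)
    (hH : ContinuousOn H {0}ᶜ) (hodd : ∀ x, x ≠ 0 → H (-x) = -H x) : ∃ x, x ≠ 0 ∧ H x = 0 := by
  obtain ⟨n, hn⟩ : ∃ n, Module.finrank ℝ E = n + 1 := ⟨Module.finrank ℝ E - 1, by omega⟩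
  let e : E ≃L[ℝ] (Fin (n + 1) → ℝ) := ContinuousLinearEquiv.ofFinrankEq (by simp [hn])
  let f : F ≃L[ℝ] (Fin (Module.finrank ℝ F) → ℝ) := ContinuousLinearEquiv.ofFinrankEq (by simp)
  obtain ⟨x, hx, hx0⟩ := borsukUlam (n := n) (by omega) (fun x => f (H (e.symm x)))
    (f.continuous.comp_continuousOn (hH.comp e.symm.continuous.continuousOn
      fun x hx => by simpa using hx))
    (fun x hx => by simp [hodd (e.symm x) (by simpa using hx)])
  exact ⟨e.symm x, by simpa using hx, by simpa using hx0⟩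

/-- A continuous self-map of `ℝ^d` at bounded distance from the identity is surjective. -/
theorem surjective_of_dist_id_le {F : Type*} [NormedAddCommGroup F] [NormedSpace ℝ F]
    [FiniteDimensional ℝ F] {G : F → F} (hG : Continuous G) {C : ℝ} (hC : ∀ x, ‖G x - x‖ ≤ C) :
    Function.Surjective G := by
  intro p
  by_contra! hp
  let D : F → F := fun x => G x - x - p
  have hD : Continuous D := by fun_prop
  have hDb : ∀ x, ‖D x‖ ≤ C + ‖p‖ := fun x => (norm_sub_le _ _).trans (by linarith [hC x])
  -- For `t ≠ 0` this is `t • (G (x / t) - p)`. It is odd, and boundedness of `D` extends it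
  -- continuously by `x` at `t = 0`; a nontrivial zero is a solution of `G = p`.
  let H : F × ℝ → F := fun z => z.1 + z.2 • D (z.2⁻¹ • z.1)
  have hcont : Continuous H := by
    refine continuous_iff_continuousAt.2 fun ⟨x, t⟩ => ?_
    refine continuousAt_fst.add ?_
    by_cases ht : t = 0
    · subst ht
      have h0 : Filter.Tendsto (fun z : F × ℝ => |z.2| * (C + ‖p‖)) (nhds (x, 0)) (nhds 0) := by
        have : ContinuousAt (fun z : F × ℝ => |z.2| * (C + ‖p‖)) (x, 0) := by fun_prop
        simpa [ContinuousAt] using this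
      simp only [ContinuousAt, zero_smul]
      refine squeeze_zero_norm (fun z => ?_) h0
      rw [norm_smul, Real.norm_eq_abs]
      exact mul_le_mul_of_nonneg_left (hDb _) (abs_nonneg _)
    · exact continuousAt_snd.smul (hD.continuousAt.comp
        ((continuousAt_snd.inv₀ ht).smul continuousAt_fst))
  obtain ⟨⟨x, t⟩, hne, h0⟩ := borsukUlam_of_finrank_lt (by simp) H hcont.continuousOn
    (fun z _ => by simp [H, inv_neg, add_comm])
  by_cases ht : t = 0
  · subst ht
    simp only [H, zero_smul, add_zero] at h0
    exact hne (by simp [h0])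
  · have h1 : t⁻¹ • H (x, t) = 0 := by rw [h0, smul_zero]
    simp only [H, smul_add, smul_smul, inv_mul_cancel₀ ht, one_smul, D] at h1
    exact hp (t⁻¹ • x) (sub_eq_zero.1 (by rw [← h1]; abel))

end BorsukUlam

/-! ### Radial extension of the homeomorphism to cones -/

section Radial

/-- A bounded continuous map on a closed cross-section of a cone extends to a continuous map of the
whole space that is positively homogeneous on the cone. -/
lemma exists_radial_extension {A B : Type*} [NormedAddCommGroup A] [NormedSpace ℝ A]
    [NormedAddCommGroup B] [NormedSpace ℝ B] [FiniteDimensional ℝ B] {S : Set A} (hS : IsClosed S)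
    {ρ : A → ℝ} (hρ : Continuous ρ) (hρh : ∀ (r : ℝ) (y : A), 0 ≤ r → ρ (r • y) = r * ρ y)
    (hρS : ∀ y ∈ S, ρ y = 1) {k : S → B} (hk : Continuous k) (hk1 : ∀ y, ‖k y‖ ≤ 1) :
    ∃ Φ : A → B, Continuous Φ ∧ ∀ (r : ℝ) (y : S), 0 ≤ r → Φ (r • (y : A)) = r • k y := by
  have : TietzeExtension (Metric.closedBall (0 : B) 1) :=
    Set.instTietzeExtensionUnitClosedBall (𝕜 := ℝ)
  obtain ⟨g, hg1, hg⟩ := ContinuousMap.exists_forall_mem_restrict_eq hS (Y := B)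
    (t := Metric.closedBall (0 : B) 1) (f := ⟨k, hk⟩) (by simpa using hk1)
  have hgk : ∀ y : S, g y = k y := fun y => congrArg (fun f : C(S, B) => f y) hg
  -- The Tietze extension `g` stays in the unit ball, so the factor `ρ y` forces continuity where
  -- `ρ` vanishes.
  refine ⟨fun y => ρ y • g ((ρ y)⁻¹ • y), continuous_iff_continuousAt.2 fun y => ?_,
    fun r y hr => ?_⟩
  · by_cases hy : ρ y = 0
    · have h0 : Filter.Tendsto (fun z => |ρ z|) (nhds y) (nhds 0) := by
        simpa [hy, Function.comp_def] using (continuous_abs.comp hρ).tendsto y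
      simp only [ContinuousAt, hy, zero_smul]
      refine squeeze_zero_norm (fun z => ?_) h0
      rw [norm_smul, Real.norm_eq_abs]
      exact mul_le_of_le_one_right (abs_nonneg _) (by simpa using hg1 _)
    · exact hρ.continuousAt.smul (g.continuous.continuousAt.comp
        ((hρ.continuousAt.inv₀ hy).smul continuousAt_id))
  · simp only [hρh r _ hr, hρS y y.2, mul_one]
    rcases hr.eq_or_lt with rfl | hr
    · simp
    · rw [smul_smul, inv_mul_cancel₀ hr.ne', one_smul, hgk]

variable {V : Type*} [Fintype V] {K : PreAbstractSimplicialComplex V} {d : ℕ}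

lemma norm_le_one_of_mem_realization {y : V → ℝ} (hy : y ∈ realization K) : ‖y‖ ≤ 1 :=
  (pi_norm_le_iff_of_nonneg zero_le_one).2 fun v => by
    rw [Real.norm_eq_abs, abs_of_nonneg (hy.1.1 v), ← hy.1.2]
    exact Finset.single_le_sum (fun w _ => hy.1.1 w) (Finset.mem_univ v)

lemma isClosed_realization (h : realization K ≃ₜ Metric.sphere (0 : EuclideanSpace ℝ (Fin d)) 1) :
    IsClosed (realization K) :=
  have : CompactSpace (realization K) := h.symm.compactSpace
  (isCompact_iff_compactSpace.2 this).isClosed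

/-- The radial extension of a homeomorphism onto the sphere to the cone over the complex. -/
lemma exists_cone_map (h : realization K ≃ₜ Metric.sphere (0 : EuclideanSpace ℝ (Fin d)) 1) :
    ∃ Φ : (V → ℝ) → EuclideanSpace ℝ (Fin d), Continuous Φ ∧
      ∀ (r : ℝ) (y : realization K), 0 ≤ r → Φ (r • (y : V → ℝ)) = r • (h y : EuclideanSpace ℝ _) :=
  exists_radial_extension (isClosed_realization h) (ρ := fun y => ∑ v, y v) (by fun_prop)
    (fun r y _ => by simp [Finset.mul_sum]) (fun y hy => hy.1.2)
    (continuous_subtype_val.comp h.continuous) (fun y => by simp)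

/-- The inverse of the radial extension. -/
lemma exists_cone_inverse (h : realization K ≃ₜ Metric.sphere (0 : EuclideanSpace ℝ (Fin d)) 1) :
    ∃ Ψ : EuclideanSpace ℝ (Fin d) → V → ℝ, Continuous Ψ ∧
      ∀ (r : ℝ) (x : Metric.sphere (0 : EuclideanSpace ℝ (Fin d)) 1), 0 ≤ r →
        Ψ (r • (x : EuclideanSpace ℝ _)) = r • (h.symm x : V → ℝ) :=
  exists_radial_extension Metric.isClosed_sphere (ρ := fun y => ‖y‖) (by fun_prop)
    (fun r y hr => by simp [norm_smul, abs_of_nonneg hr]) (fun y hy => by simpa using hy)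
    (continuous_subtype_val.comp h.symm.continuous)
    (fun y => norm_le_one_of_mem_realization (h.symm y).2)

end Radial

/-! ### A triangulated sphere has a face of full dimension -/

section Dimension

variable {V : Type*} [Fintype V] {K : PreAbstractSimplicialComplex V} {d : ℕ}

/-- The coordinate subspace spanned by the vertices in `s`. -/
def coordinateInclusion (s : Finset V) (z : s → ℝ) : V → ℝ := by
  classical exact fun v => if h : v ∈ s then z ⟨v, h⟩ else 0

lemma contDiff_coordinateInclusion (s : Finset V) : ContDiff ℝ 1 (coordinateInclusion s) := by
  refine contDiff_pi.2 fun v => ?_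
  unfold coordinateInclusion
  by_cases h : v ∈ s
  · simp only [h, dite_true]
    exact contDiff_apply ℝ ℝ _
  · simp only [h, dite_false]
    exact contDiff_const

lemma mem_range_coordinateInclusion {V : Type*} {s : Finset V} {y : V → ℝ} (hy : ∀ v, y v ≠ 0 → v ∈ s) :
    y ∈ Set.range (coordinateInclusion s) := by
  refine ⟨fun v => y v, funext fun v => ?_⟩
  unfold coordinateInclusion
  split_ifs with h
  · rfl
  · by_contra h'
    exact h (hy v (Ne.symm h'))

/-- A triangulation of the `(d - 1)`-sphere has a face with at least `d` vertices. -/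
theorem IsSphereTriangulation.exists_card_ge (hK : IsSphereTriangulation K d) [Nonempty V] :
    ∃ s ∈ K, d ≤ s.card := by
  obtain ⟨h⟩ := hK.homeomorphic
  by_contra! hlt
  obtain ⟨v₀⟩ := ‹Nonempty V›
  have hd : 0 < d := by
    have := hlt _ (hK.singleton_mem v₀)
    omega
  have : Nonempty (Fin d) := ⟨⟨0, hd⟩⟩
  obtain ⟨x₀, hx₀⟩ : (Metric.sphere (0 : EuclideanSpace ℝ (Fin d)) 1).Nonempty :=
    NormedSpace.sphere_nonempty.2 zero_le_one
  obtain ⟨Φ, hΦ, hΦh⟩ := exists_cone_map h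
  obtain ⟨Ψ, hΨ, hΨh⟩ := exists_cone_inverse h
  -- `Φ` is only continuous and could raise dimension, so it is replaced by a C¹ map within distance
  -- 1; then `g ∘ Ψ` stays within 1 of `Φ ∘ Ψ = id` and is surjective.
  obtain ⟨g, hg, hgΦ, -⟩ := hΦ.exists_contDiff_approx 1 (ε := fun _ => 1) continuous_const
    (fun _ => one_pos)
  have hcone : ∀ x, ∃ r : ℝ, 0 ≤ r ∧ ∃ u : Metric.sphere (0 : EuclideanSpace ℝ (Fin d)) 1,
      x = r • (u : EuclideanSpace ℝ (Fin d)) := by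
    intro x
    by_cases hx : x = 0
    · exact ⟨0, le_rfl, ⟨x₀, hx₀⟩, by simp [hx]⟩
    · have hx' : ‖x‖ ≠ 0 := norm_ne_zero_iff.2 hx
      exact ⟨‖x‖, norm_nonneg x, ⟨‖x‖⁻¹ • x, by simp [norm_smul, hx']⟩, by simp [smul_smul, hx']⟩
  have hΦΨ : ∀ x, Φ (Ψ x) = x := by
    intro x
    obtain ⟨r, hr, u, rfl⟩ := hcone x
    rw [hΨh r u hr, hΦh r _ hr, h.apply_symm_apply]
  have hsurj : Function.Surjective fun x => g (Ψ x) := by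
    refine surjective_of_dist_id_le (hg.continuous.comp hΨ) (C := 1) fun x => ?_
    have := hgΦ (Ψ x)
    rw [hΦΨ, dist_eq_norm] at this
    exact this.le
  have hcover : (Set.univ : Set (EuclideanSpace ℝ (Fin d))) ⊆
      ⋃ s : {s : Finset V // s ∈ K}, Set.range (g ∘ coordinateInclusion (s : Finset V)) := by
    intro p _
    obtain ⟨x, rfl⟩ := hsurj p
    obtain ⟨r, hr, u, rfl⟩ := hcone x
    obtain ⟨s, hs, hsu⟩ := (h.symm u).2.2
    refine Set.mem_iUnion.2 ⟨⟨s, hs⟩, ?_⟩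
    rw [Set.range_comp]
    refine Set.mem_image_of_mem g (mem_range_coordinateInclusion fun v hv => hsu v ?_)
    rw [hΨh r u hr] at hv
    exact right_ne_zero_of_mul hv
  have h1 := dimH_mono hcover
  rw [Real.dimH_univ_eq_finrank, dimH_iUnion, finrank_euclideanSpace, Fintype.card_fin] at h1
  have h2 : (⨆ s : {s : Finset V // s ∈ K},
      dimH (Set.range (g ∘ coordinateInclusion (s : Finset V)))) ≤ ((d - 1 : ℕ) : ENNReal) := by
    refine iSup_le fun s => ?_
    refine (ContDiff.dimH_range_le (hg.comp (contDiff_coordinateInclusion _))).trans ?_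
    have := hlt s s.2
    simp only [Module.finrank_fintype_fun_eq_card, Fintype.card_coe]
    exact_mod_cast Nat.le_sub_one_of_lt this
  have h3 := h1.trans h2
  have : d ≤ d - 1 := by exact_mod_cast h3
  omega

end Dimension

/-! ### Colourings of missing faces: upper and lower bound -/

section KneserGraph

variable {V : Type*} {K : PreAbstractSimplicialComplex V} {d : ℕ}

lemma exists_missingFace_subset {t : Finset V} (ht : t.Nonempty) (htK : t ∉ K) :
    ∃ s ∈ missingFaces K ⊤, s ⊆ t := by
  induction t using Finset.strongInduction with
  | H t ih =>
    by_cases h : ∃ u ⊂ t, u.Nonempty ∧ u ∉ K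
    · obtain ⟨u, hut, hu, huK⟩ := h
      obtain ⟨s, hs, hsu⟩ := ih u hut hu huK
      exact ⟨s, hs, hsu.trans hut.1⟩
    · push Not at h
      refine ⟨t, ⟨⟨ht, htK⟩, fun u hu hut => ?_⟩, subset_rfl⟩
      by_contra htu
      exact hu.2 (h u ⟨hut, htu⟩ hu.1)

lemma nonempty_of_mem_missingFaces {s : Finset V} (hs : s ∈ missingFaces K ⊤) : s.Nonempty :=
  Minimal.prop (P := fun t => t ∈ (⊤ : PreAbstractSimplicialComplex V) ∧ t ∉ K) hs |>.1

lemma notMem_of_mem_missingFaces {s : Finset V} (hs : s ∈ missingFaces K ⊤) : s ∉ K :=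
  Minimal.prop (P := fun t => t ∈ (⊤ : PreAbstractSimplicialComplex V) ∧ t ∉ K) hs |>.2

/-- Coloring a missing face by a vertex outside a given face is proper. -/
theorem colorable_kneserGraph [Fintype V] {s : Finset V} (hs : s ∈ K) :
    (kneserGraph K ⊤).Colorable (Fintype.card V - s.card) := by
  classical
  have hout : ∀ F : missingFaces K ⊤, ∃ v, v ∈ (F : Finset V) ∧ v ∉ s := by
    intro F
    by_contra! hF
    exact notMem_of_mem_missingFaces F.2 ((K.isRelLowerSet_faces hs).2 hF (nonempty_of_mem_missingFaces F.2))
  choose f hf hfs using hout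
  let C : (kneserGraph K ⊤).Coloring {v // v ∉ s} := SimpleGraph.Coloring.mk
    (fun F => ⟨f F, hfs F⟩) fun {F G} hFG heq => by
      have h1 : f F = f G := congrArg Subtype.val heq
      exact Finset.disjoint_left.1 hFG.2 (hf F) (h1 ▸ hf G)
  have := C.colorable
  rwa [Fintype.card_subtype_compl, Fintype.card_coe] at this

/-- A nonnegative vector whose support contains no missing face lies in the cone over the
realization. -/
lemma exists_eq_smul_realization [Fintype V] {y : V → ℝ} (hy : ∀ v, 0 ≤ y v) (hy0 : y ≠ 0)
    (hmiss : ∀ F ∈ missingFaces K ⊤, ∏ v ∈ F, y v = 0) :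
    ∃ r : ℝ, 0 < r ∧ ∃ u : realization K, y = r • (u : V → ℝ) := by
  classical
  obtain ⟨w, hw⟩ := Function.ne_iff.1 hy0
  have hpos : 0 < ∑ v, y v := Finset.sum_pos' (fun v _ => hy v)
    ⟨w, Finset.mem_univ w, (hy w).lt_of_ne' hw⟩
  refine ⟨∑ v, y v, hpos, ⟨(∑ v, y v)⁻¹ • y, ⟨fun v => ?_, ?_⟩,
    Finset.univ.filter (y · ≠ 0), ?_, ?_⟩, ?_⟩
  · exact mul_nonneg (inv_nonneg.2 hpos.le) (hy v)
  · simp [← Finset.mul_sum, hpos.ne']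
  · by_contra hK
    obtain ⟨F, hF, hFs⟩ := exists_missingFace_subset (K := K)
      (t := ({v | y v ≠ 0} : Finset V)) ⟨w, by simpa using hw⟩ hK
    obtain ⟨v, hv, hv0⟩ := Finset.prod_eq_zero_iff.1 (hmiss F hF)
    exact (Finset.mem_filter.1 (hFs hv)).2 hv0
  · intro v hv
    simpa using right_ne_zero_of_mul hv
  · simp [smul_smul, hpos.ne']

/-- **Sarkaria's bound** for triangulated spheres. -/
theorem IsSphereTriangulation.card_le_of_colorable [Fintype V] (hK : IsSphereTriangulation K d)
    {c : ℕ} (hc : (kneserGraph K ⊤).Colorable c) : Fintype.card V ≤ c + d := by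
  classical
  obtain ⟨h⟩ := hK.homeomorphic
  obtain ⟨C⟩ := hc
  obtain ⟨Φ, hΦ, hΦh⟩ := exists_cone_map h
  by_contra! hlt
  let pos : (V → ℝ) → V → ℝ := fun z v => max (z v) 0
  have hpos : Continuous pos := by fun_prop
  have hpos0 : ∀ z v, 0 ≤ pos z v := fun z v => le_max_right _ _
  let P : (V → ℝ) → Fin c → ℝ := fun z i =>
    ∑ F : missingFaces K ⊤, if C F = i then ∏ v ∈ (F : Finset V), pos z v else 0
  have hP : Continuous P := by
    refine continuous_pi fun i => continuous_finsetSum _ fun F _ => ?_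
    split_ifs
    · exact continuous_finsetProd _ fun v _ => (continuous_apply v).comp hpos
    · exact continuous_const
  let H : (V → ℝ) → (Fin c → ℝ) × EuclideanSpace ℝ (Fin d) := fun z =>
    (P z - P (-z), Φ (pos z) - Φ (pos (-z)))
  have hH : Continuous H := by fun_prop
  obtain ⟨z, hz, hHz⟩ := borsukUlam_of_finrank_lt (by simpa using hlt) H hH.continuousOn
    (fun z _ => by simp [H])
  have hPz : P z = P (-z) := sub_eq_zero.1 (congrArg Prod.fst hHz)
  have hΦz : Φ (pos z) = Φ (pos (-z)) := sub_eq_zero.1 (congrArg Prod.snd hHz)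
  have hdisj : ∀ v, pos z v = 0 ∨ pos (-z) v = 0 := fun v => by
    simp only [pos, Pi.neg_apply]
    rcases le_total (z v) 0 with h | h
    · exact Or.inl (max_eq_right h)
    · exact Or.inr (max_eq_right (by linarith))
  have hterm : ∀ (z : V → ℝ) (i : Fin c) (F : missingFaces K ⊤),
      0 ≤ if C F = i then ∏ v ∈ (F : Finset V), pos z v else 0 := fun z i F => by
    split_ifs
    · exact Finset.prod_nonneg fun v _ => hpos0 z v
    · exact le_rfl
  -- A missing face in the positive support makes its colour sum positive, so the negative support
  -- holds a missing face of the same colour, disjoint from it.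
  have hzero : ∀ z : V → ℝ, P z = P (-z) → (∀ v, pos z v = 0 ∨ pos (-z) v = 0) →
      ∀ F ∈ missingFaces K ⊤, ∏ v ∈ F, pos z v = 0 := by
    intro z hPz hdisj F hF
    by_contra hne
    have h1 : 0 < P z (C ⟨F, hF⟩) := Finset.sum_pos' (fun G _ => hterm z _ G)
      ⟨⟨F, hF⟩, Finset.mem_univ _, by
        simpa using (Finset.prod_nonneg fun v _ => hpos0 z v).lt_of_ne' hne⟩
    rw [hPz] at h1
    obtain ⟨G, -, hG⟩ := Finset.exists_ne_zero_of_sum_ne_zero h1.ne'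
    have hcol : C G = C ⟨F, hF⟩ := by
      by_contra hcol
      exact hG (if_neg hcol)
    rw [if_pos hcol] at hG
    have hGF : Disjoint (G : Finset V) F := Finset.disjoint_left.2 fun v hvG hvF =>
      (hdisj v).elim (fun h => hne (Finset.prod_eq_zero hvF h))
        fun h => hG (Finset.prod_eq_zero hvG h)
    refine C.valid (v := G) (w := ⟨F, hF⟩) ⟨?_, hGF⟩ hcol
    rintro rfl
    exact (nonempty_of_mem_missingFaces hF).ne_empty (disjoint_self.1 hGF)
  have hz1 := hzero z hPz hdisj
  have hz2 := hzero (-z) (by rw [neg_neg, hPz]) (fun v => by rw [neg_neg]; exact (hdisj v).symm)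
  have hnorm : ∀ (r : ℝ) (u : realization K), 0 < r → Φ (r • (u : V → ℝ)) ≠ 0 := by
    intro r u hr h0
    rw [hΦh r u hr.le] at h0
    have := congrArg norm h0
    rw [norm_smul, norm_eq_of_mem_sphere, norm_zero, mul_one, Real.norm_eq_abs, abs_of_pos hr]
      at this
    exact hr.ne' this
  have hΦ0 : ∀ u : realization K, Φ 0 = 0 := fun u => by
    simpa using hΦh 0 u le_rfl
  by_cases h1 : pos z = 0
  · by_cases h2 : pos (-z) = 0
    · refine hz (funext fun v => le_antisymm ?_ ?_)
      · exact max_eq_right_iff.1 (congrFun h1 v)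
      · have : -z v ≤ 0 := max_eq_right_iff.1 (congrFun h2 v)
        simpa using this
    · obtain ⟨r, hr, u, hu⟩ := exists_eq_smul_realization (hpos0 _) h2 hz2
      rw [h1, hu, hΦ0 u] at hΦz
      exact hnorm r u hr hΦz.symm
  · obtain ⟨r, hr, u, hu⟩ := exists_eq_smul_realization (hpos0 _) h1 hz1
    by_cases h2 : pos (-z) = 0
    · rw [h2, hu, hΦ0 u] at hΦz
      exact hnorm r u hr hΦz
    · obtain ⟨r', hr', u', hu'⟩ := exists_eq_smul_realization (hpos0 _) h2 hz2
      rw [hu, hu', hΦh r u hr.le, hΦh r' u' hr'.le] at hΦz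
      -- Norms recover the radial coordinate; injectivity of `h` then recovers the point of the
      -- realization.
      have hrr : r = r' := by
        have := congrArg norm hΦz
        rwa [norm_smul, norm_smul, norm_eq_of_mem_sphere, norm_eq_of_mem_sphere, mul_one, mul_one,
          Real.norm_eq_abs, Real.norm_eq_abs, abs_of_pos hr, abs_of_pos hr'] at this
      subst hrr
      have huu : u = u' := h.injective (Subtype.ext (smul_right_injective _ hr.ne' hΦz))
      refine h1 (funext fun v => ?_)
      rcases hdisj v with h | h
      · exact h
      · rw [hu, huu, ← hu']
        exact h

/-- The chromatic number of the Kneser graph of the missing faces of a triangulated sphere. -/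
theorem IsSphereTriangulation.chromaticNumber_add [Fintype V] [Nonempty V]
    (hK : IsSphereTriangulation K d) :
    (kneserGraph K ⊤).chromaticNumber + (d : ℕ∞) = (Fintype.card V : ℕ∞) := by
  obtain ⟨s, hs, hd⟩ := hK.exists_card_ge
  have hcol : (kneserGraph K ⊤).Colorable (Fintype.card V - d) :=
    (colorable_kneserGraph hs).mono (by omega)
  have hdV : d ≤ Fintype.card V := hd.trans s.card_le_univ
  have h : (kneserGraph K ⊤).chromaticNumber = (Fintype.card V - d : ℕ) := by
    refine le_antisymm hcol.chromaticNumber_le (SimpleGraph.le_chromaticNumber_iff_colorable.2 ?_)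
    intro m hm
    have := hK.card_le_of_colorable hm
    exact_mod_cast Nat.sub_le_iff_le_add.2 this
  rw [h]
  exact_mod_cast Nat.sub_add_cancel hdV

end KneserGraph

/-! ### Boundary complexes of simplicial polytopes are spheres -/

section BoundaryComplex

variable {ι E : Type*} [NormedAddCommGroup E] [NormedSpace ℝ E] {p : ι → E}

lemma eq_on_convexHull_of_eq {l : E →L[ℝ] ℝ} {c : ℝ} (h : ∀ i, l (p i) = c) :
    ∀ x ∈ convexHull ℝ (Set.range p), l x = c := fun _ hx =>
  convexHull_min (t := {x | l x = c}) (Set.range_subset_iff.2 h)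
    (convex_hyperplane l.toLinearMap.isLinear c) hx

lemma le_on_convexHull_of_le {l : E →L[ℝ] ℝ} {c : ℝ} (h : ∀ i, l (p i) ≤ c) :
    ∀ x ∈ convexHull ℝ (Set.range p), l x ≤ c := fun _ hx =>
  convexHull_min (t := {x | l x ≤ c}) (Set.range_subset_iff.2 h)
    (convex_halfSpace_le l.toLinearMap.isLinear c) hx

/-- The faces of the boundary complex in terms of supporting hyperplanes. -/
lemma mem_boundaryComplex_iff {s : Finset ι} : s ∈ boundaryComplex p ↔
    s.Nonempty ∧ ∃ (l : E →L[ℝ] ℝ) (c : ℝ), (∀ i, l (p i) ≤ c) ∧ (∃ i, l (p i) < c) ∧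
      ∀ i ∈ s, l (p i) = c := by
  have hp : ∀ i, p i ∈ convexHull ℝ (Set.range p) := fun i =>
    subset_convexHull ℝ _ (Set.mem_range_self i)
  constructor
  · rintro ⟨⟨i₀, hi₀⟩, F, hF, hne, hsF⟩
    obtain ⟨l, rfl⟩ := hF ⟨_, hsF i₀ hi₀⟩
    refine ⟨⟨i₀, hi₀⟩, l, l (p i₀), fun i => (hsF i₀ hi₀).2 _ (hp i), ?_, fun i hi =>
      le_antisymm ((hsF i₀ hi₀).2 _ (hp i)) ((hsF i hi).2 _ (hp i₀))⟩
    by_contra! hle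
    have heq : ∀ i, l (p i) = l (p i₀) := fun i =>
      le_antisymm ((hsF i₀ hi₀).2 _ (hp i)) (hle i)
    refine hne (Set.Subset.antisymm (fun x hx => hx.1) fun x hx => ⟨hx, fun y hy => ?_⟩)
    rw [eq_on_convexHull_of_eq heq x hx, eq_on_convexHull_of_eq heq y hy]
  · rintro ⟨⟨i₀, hi₀⟩, l, c, hle, ⟨j, hj⟩, hs⟩
    refine ⟨⟨i₀, hi₀⟩, {x | x ∈ convexHull ℝ (Set.range p) ∧
      ∀ y ∈ convexHull ℝ (Set.range p), l y ≤ l x}, fun _ => ⟨l, rfl⟩, fun h => ?_, fun i hi =>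
      ⟨hp i, fun y hy => (le_on_convexHull_of_le hle y hy).trans (hs i hi).ge⟩⟩
    have := (h.ge (hp j)).2 _ (hp i₀)
    rw [hs i₀ hi₀] at this
    exact this.not_gt hj

variable [Fintype ι]

lemma map_linearCombination (l : E →L[ℝ] ℝ) (x : ι → ℝ) :
    l (Fintype.linearCombination ℝ p x) = ∑ i, x i * l (p i) := by
  simp [Fintype.linearCombination_apply]

lemma image_stdSimplex_eq_convexHull :
    Fintype.linearCombination ℝ p '' stdSimplex ℝ ι = convexHull ℝ (Set.range p) := by
  classical
  rw [← convexHull_rangle_single_eq_stdSimplex, LinearMap.image_convexHull, ← Set.range_comp]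
  congr 2
  ext i
  simp [Fintype.linearCombination_apply]

/-- A convex combination attains the maximum of a linear functional exactly when all vertices
involved do. -/
lemma map_linearCombination_eq_iff {l : E →L[ℝ] ℝ} {c : ℝ} (hle : ∀ i, l (p i) ≤ c) {x : ι → ℝ}
    (hx : x ∈ stdSimplex ℝ ι) :
    l (Fintype.linearCombination ℝ p x) = c ↔ ∀ i, x i ≠ 0 → l (p i) = c := by
  have h1 : c - l (Fintype.linearCombination ℝ p x) = ∑ i, x i * (c - l (p i)) := by
    simp_rw [map_linearCombination, mul_sub, Finset.sum_sub_distrib, ← Finset.sum_mul]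
    rw [hx.2, one_mul]
  have h2 : ∀ i ∈ Finset.univ, 0 ≤ x i * (c - l (p i)) := fun i _ =>
    mul_nonneg (hx.1 i) (sub_nonneg.2 (hle i))
  rw [eq_comm, ← sub_eq_zero, h1, Finset.sum_eq_zero_iff_of_nonneg h2]
  simp only [Finset.mem_univ, true_imp_iff, mul_eq_zero, or_iff_not_imp_left, sub_eq_zero,
    eq_comm (a := c), Ne]

/-- A functional with a maximum at an interior point is zero, hence not supporting a proper face.
Conversely, Hahn–Banach supports the polytope at a frontier point, and every vertex of positive
weight lies on that hyperplane. -/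
lemma mem_realization_boundaryComplex_iff
    (hint : (interior (convexHull ℝ (Set.range p))).Nonempty) {x : ι → ℝ}
    (hx : x ∈ stdSimplex ℝ ι) : x ∈ realization (boundaryComplex p) ↔
      Fintype.linearCombination ℝ p x ∈ frontier (convexHull ℝ (Set.range p)) := by
  classical
  have hC : Convex ℝ (convexHull ℝ (Set.range p)) := convex_convexHull ℝ _
  have hxC : Fintype.linearCombination ℝ p x ∈ convexHull ℝ (Set.range p) := by
    rw [← image_stdSimplex_eq_convexHull]; exact Set.mem_image_of_mem _ hx
  constructor
  · rintro ⟨-, s, hs, hsx⟩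
    obtain ⟨-, l, c, hle, ⟨j, hj⟩, hs⟩ := mem_boundaryComplex_iff.1 hs
    refine ⟨subset_closure hxC, fun hxi => ?_⟩
    have h1 := (map_linearCombination_eq_iff hle hx).2 fun i hi => hs i (hsx i hi)
    have h2 : IsLocalMax l (Fintype.linearCombination ℝ p x) := by
      filter_upwards [isOpen_interior.mem_nhds hxi] with y hy
      rw [h1]
      exact le_on_convexHull_of_le hle y (interior_subset hy)
    have h3 : l = 0 := h2.hasFDerivAt_eq_zero l.hasFDerivAt
    subst h3
    simp only [zero_apply] at h1 hj
    exact hj.ne h1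
  · rintro ⟨-, hxi⟩
    obtain ⟨l, hl⟩ := geometric_hahn_banach_open_point hC.interior isOpen_interior hxi
    have hle : ∀ y ∈ convexHull ℝ (Set.range p), l y ≤ l (Fintype.linearCombination ℝ p x) := by
      intro y hy
      have : y ∈ closure (interior (convexHull ℝ (Set.range p))) := by
        rw [hC.closure_interior_eq_closure_of_nonempty_interior hint]
        exact subset_closure hy
      exact closure_minimal (fun z hz => (hl z hz).le) (isClosed_le l.continuous continuous_const)
        this
    have hlep : ∀ i, l (p i) ≤ l (Fintype.linearCombination ℝ p x) := fun i =>
      hle _ (subset_convexHull ℝ _ (Set.mem_range_self i))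
    have hex : ∃ i, x i ≠ 0 := by
      by_contra! h
      simpa [h] using hx.2
    refine ⟨hx, Finset.univ.filter (x · ≠ 0), mem_boundaryComplex_iff.2 ⟨?_, l, _, hlep, ?_,
      fun i hi => (map_linearCombination_eq_iff hlep hx).1 rfl i (Finset.mem_filter.1 hi).2⟩,
      fun i hi => Finset.mem_filter.2 ⟨Finset.mem_univ i, hi⟩⟩
    · obtain ⟨i, hi⟩ := hex
      exact ⟨i, Finset.mem_filter.2 ⟨Finset.mem_univ i, hi⟩⟩
    · by_contra! hge
      obtain ⟨z, hz⟩ := hint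
      exact (hl z hz).ne (eq_on_convexHull_of_eq (fun i => le_antisymm (hlep i) (hge i)) z
        (interior_subset hz))

/-- The boundary complex of a full-dimensional polytope all of whose proper faces are simplices
triangulates the boundary of the polytope. -/
theorem nonempty_realization_homeomorph_sphere [FiniteDimensional ℝ E]
    (hint : (interior (convexHull ℝ (Set.range p))).Nonempty)
    (hsimp : ∀ (l : E →L[ℝ] ℝ) (c : ℝ), (∀ i, l (p i) ≤ c) → (∃ i, l (p i) < c) →
      ∀ w : ι → ℝ, (∀ i, w i ≠ 0 → l (p i) = c) → ∑ i, w i = 0 →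
        Fintype.linearCombination ℝ p w = 0 → w = 0) :
    Nonempty (realization (boundaryComplex p) ≃ₜ Metric.sphere (0 : E) 1) := by
  set C := convexHull ℝ (Set.range p) with hC
  have hCc : IsCompact C := (Set.finite_range p).isCompact_convexHull ℝ
  have hcont : Continuous (Fintype.linearCombination ℝ p) := LinearMap.continuous_of_finiteDimensional _
  have hreal : realization (boundaryComplex p) =
      stdSimplex ℝ ι ∩ Fintype.linearCombination ℝ p ⁻¹' frontier C := by
    ext x
    exact ⟨fun hx => ⟨hx.1, (mem_realization_boundaryComplex_iff hint hx.1).1 hx⟩,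
      fun hx => (mem_realization_boundaryComplex_iff hint hx.1).2 hx.2⟩
  have hcomp : CompactSpace (realization (boundaryComplex p)) := by
    rw [hreal]
    exact isCompact_iff_compactSpace.1
      ((isCompact_stdSimplex ℝ ι).inter_right (isClosed_frontier.preimage hcont))
  let f : realization (boundaryComplex p) → frontier C := fun x =>
    ⟨Fintype.linearCombination ℝ p x, (mem_realization_boundaryComplex_iff hint x.2.1).1 x.2⟩
  have hf : Continuous f := (hcont.comp continuous_subtype_val).subtype_mk _
  have hbij : Function.Bijective f := by
    constructor
    · rintro ⟨x, hx⟩ ⟨y, hy⟩ hxy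
      have hxy : Fintype.linearCombination ℝ p x = Fintype.linearCombination ℝ p y :=
        congrArg Subtype.val hxy
      obtain ⟨s, hs, hsx⟩ := hx.2
      obtain ⟨-, l, c, hle, hlt, hs⟩ := mem_boundaryComplex_iff.1 hs
      have hx' := fun i hi => hs i (hsx i hi)
      -- The hyperplane supporting the face of `x` contains all vertices used by `y`, so `x - y` is
      -- an affine dependence within one proper face.
      have hy' := (map_linearCombination_eq_iff hle hy.1).1
        (hxy ▸ (map_linearCombination_eq_iff hle hx.1).2 hx')
      have h0 := hsimp l c hle hlt (x - y) (fun i hi => ?_) ?_ ?_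
      · exact Subtype.ext (sub_eq_zero.1 h0)
      · by_cases hxi : x i = 0
        · exact hy' i fun hyi => hi (by simp [hxi, hyi])
        · exact hx' i hxi
      · simp [Finset.sum_sub_distrib, hx.1.2, hy.1.2]
      · rw [map_sub, hxy, sub_self]
    · rintro ⟨y, hy⟩
      have hyC : y ∈ C := hCc.isClosed.frontier_subset hy
      rw [hC, ← image_stdSimplex_eq_convexHull] at hyC
      obtain ⟨x, hx, rfl⟩ := hyC
      exact ⟨⟨x, (mem_realization_boundaryComplex_iff hint hx).2 hy⟩, rfl⟩
  obtain ⟨h, -, -, hh⟩ := exists_homeomorph_image_interior_closure_frontier_eq_unitBall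
    (convex_convexHull ℝ (Set.range p)) hint hCc.isBounded
  have e1 : realization (boundaryComplex p) ≃ₜ frontier C :=
    Continuous.homeoOfEquivCompactToT2 (f := Equiv.ofBijective f hbij) hf
  exact ⟨e1.trans ((h.image (frontier C)).trans (Homeomorph.setCongr hh))⟩

end BoundaryComplex

/-! ### Cyclic polytopes through polynomials -/

section MomentCurve

open Polynomial

variable {d : ℕ}

/-- A linear functional restricts to a polynomial on the moment curve. -/
lemma exists_polynomial_eq_functional (l : EuclideanSpace ℝ (Fin d) →L[ℝ] ℝ) (c : ℝ) :
    ∃ q : ℝ[X], q.natDegree ≤ d ∧ ∀ x, q.eval x = c - l (momentCurve d x) := by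
  refine ⟨C c - ∑ i : Fin d, C (l (EuclideanSpace.single i 1)) * X ^ ((i : ℕ) + 1), ?_, fun x => ?_⟩
  · refine (natDegree_sub_le _ _).trans (max_le (by simp) ?_)
    refine natDegree_sum_le_of_forall_le _ _ fun i _ => (natDegree_C_mul_X_pow_le _ _).trans i.2
  · have : momentCurve d x =
        ∑ i : Fin d, x ^ ((i : ℕ) + 1) • EuclideanSpace.single i (1 : ℝ) := by
      ext j
      simp [momentCurve, Finset.sum_apply, Pi.single_apply]
    rw [this, map_sum]
    simp only [eval_sub, eval_C, eval_finsetSum, eval_mul, eval_pow, eval_X, map_smul, smul_eq_mul]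
    congr 1
    exact Finset.sum_congr rfl fun i _ => mul_comm _ _

/-- Every polynomial of degree at most `d` is an affine functional of the moment curve. -/
lemma exists_functional_eq_polynomial {q : ℝ[X]} (hq : q.natDegree ≤ d) :
    ∃ (l : EuclideanSpace ℝ (Fin d) →L[ℝ] ℝ) (c : ℝ), ∀ x, q.eval x = c - l (momentCurve d x) := by
  refine ⟨-∑ i : Fin d, q.coeff (i + 1) • EuclideanSpace.proj i, q.coeff 0, fun x => ?_⟩
  rw [eval_eq_sum_range' (Nat.lt_succ_of_le hq), Finset.sum_range_succ', ← Fin.sum_univ_eq_sum_range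
    (fun i => q.coeff (i + 1) * x ^ (i + 1))]
  simp [momentCurve, add_comm]

/-- Any `d + 1` points on the moment curve in `ℝ^d` are affinely independent. -/
lemma eq_zero_of_sum_momentCurve {ι : Type*} {t : ι → ℝ} (ht : Function.Injective t)
    {Z : Finset ι} (hZ : Z.card ≤ d + 1) {w : ι → ℝ} (h0 : ∑ i ∈ Z, w i = 0)
    (h1 : ∑ i ∈ Z, w i • momentCurve d (t i) = 0) : ∀ i ∈ Z, w i = 0 := by
  classical
  intro i hi
  have hq : (∏ j ∈ Z.erase i, (X - C (t j))).natDegree ≤ d := by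
    rw [natDegree_prod_of_monic _ _ fun j _ => monic_X_sub_C _]
    simp only [natDegree_X_sub_C, Finset.sum_const, smul_eq_mul, mul_one,
      Finset.card_erase_of_mem hi]
    omega
  obtain ⟨l, c, hl⟩ := exists_functional_eq_polynomial hq
  have h2 : ∑ j ∈ Z, w j * (∏ j ∈ Z.erase i, (X - C (t j))).eval (t j) = 0 := by
    simp_rw [hl, mul_sub, Finset.sum_sub_distrib, ← Finset.sum_mul, h0, zero_mul, zero_sub]
    rw [← neg_zero, ← map_zero l, ← h1, map_sum]
    simp
  rw [Finset.sum_eq_single_of_mem i hi fun j hj hji => ?_] at h2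
  · refine (mul_eq_zero.1 h2).resolve_right ?_
    rw [eval_prod]
    refine Finset.prod_ne_zero_iff.2 fun j hj => ?_
    simpa [sub_eq_zero] using fun h => (Finset.mem_erase.1 hj).1 (ht h).symm
  · rw [eval_prod, Finset.prod_eq_zero (Finset.mem_erase.2 ⟨hji, hj⟩) (by simp), mul_zero]

/-- The faces of a cyclic polytope in terms of polynomials. -/
lemma mem_cyclicBoundary_iff {m : ℕ} {t : Fin m → ℝ} {s : Finset (Fin m)} :
    s ∈ cyclicBoundary d t ↔ s.Nonempty ∧ ∃ q : ℝ[X], q.natDegree ≤ d ∧ (∀ i, 0 ≤ q.eval (t i)) ∧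
      (∃ i, q.eval (t i) ≠ 0) ∧ ∀ i ∈ s, q.eval (t i) = 0 := by
  rw [cyclicBoundary, mem_boundaryComplex_iff]
  refine and_congr_right fun _ => ⟨?_, ?_⟩
  · rintro ⟨l, c, h1, ⟨i, h2⟩, h3⟩
    obtain ⟨q, hq, hql⟩ := exists_polynomial_eq_functional l c
    refine ⟨q, hq, fun i => ?_, ⟨i, ?_⟩, fun i hi => ?_⟩
    · rw [hql]; exact sub_nonneg.2 (h1 i)
    · rw [hql]; exact (sub_pos.2 h2).ne'
    · rw [hql]; exact sub_eq_zero.2 (h3 i hi).symm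
  · rintro ⟨q, hq, h1, ⟨i, h2⟩, h3⟩
    obtain ⟨l, c, hql⟩ := exists_functional_eq_polynomial hq
    simp only [hql] at h1 h2 h3
    exact ⟨l, c, fun i => sub_nonneg.1 (h1 i), ⟨i, sub_pos.1 ((h1 i).lt_of_ne' h2)⟩,
      fun i hi => (sub_eq_zero.1 (h3 i hi)).symm⟩

/-- The boundary complex of a cyclic polytope is homeomorphic to a sphere. -/
theorem nonempty_realization_cyclicBoundary_homeomorph {m : ℕ} (hm : d + 1 ≤ m) {t : Fin m → ℝ}
    (ht : Function.Injective t) : Nonempty (realization (cyclicBoundary d t) ≃ₜ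
      Metric.sphere (0 : EuclideanSpace ℝ (Fin d)) 1) := by
  classical
  refine nonempty_realization_homeomorph_sphere ?_ ?_
  · rw [interior_convexHull_nonempty_iff_affineSpan_eq_top]
    have hind : AffineIndependent ℝ fun i : Fin (d + 1) => momentCurve d (t (Fin.castLE hm i)) :=
      affineIndependent_iff.2 fun s w h0 h1 => eq_zero_of_sum_momentCurve
        (ht.comp (Fin.castLE_injective hm)) (s.card_le_univ.trans (by simp)) h0 h1
    refine top_le_iff.1 ((hind.affineSpan_eq_top_iff_card_eq_finrank_add_one.2 (by simp)).symm.le.trans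
      (affineSpan_mono ℝ ?_))
    rintro _ ⟨i, rfl⟩
    exact Set.mem_range_self _
  · intro l c hle ⟨j, hj⟩ w hw h0 h1
    obtain ⟨q, hq, hql⟩ := exists_polynomial_eq_functional l c
    have hq0 : q ≠ 0 := by
      rintro rfl
      have := hql (t j)
      rw [eval_zero] at this
      linarith
    set Z : Finset (Fin m) := Finset.univ.filter (w · ≠ 0) with hZdef
    -- A supporting hyperplane meets the curve in the roots of a nonzero polynomial of degree at
    -- most `d`.
    have hZ : Z.card ≤ d := by
      by_contra! hlt
      refine hq0 (eq_zero_of_natDegree_lt_card_of_eval_eq_zero' q (Z.image t) ?_ ?_)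
      · intro x hx
        obtain ⟨i, hi, rfl⟩ := Finset.mem_image.1 hx
        rw [hql, hw i (Finset.mem_filter.1 hi).2, sub_self]
      · rw [Finset.card_image_of_injective _ ht]
        omega
    have hz : ∀ i ∉ Z, w i = 0 := fun i hi => by simpa [hZdef] using hi
    have h2 := eq_zero_of_sum_momentCurve (d := d) (w := w) ht (Z := Z) (by omega)
      (by rw [← h0]; exact Finset.sum_subset (Finset.subset_univ _) fun i _ hi => hz i hi)
      (by
        rw [← h1, Fintype.linearCombination_apply]
        exact Finset.sum_subset (Finset.subset_univ _) fun i _ hi => by rw [hz i hi, zero_smul])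
    funext i
    by_cases hi : i ∈ Z
    · exact h2 i hi
    · exact hz i hi

end MomentCurve

/-! ### Gale's evenness condition and the missing faces -/

section GaleEvenness

open Polynomial

/-- A polynomial of degree less than `2 n - 1` that vanishes at `n` nodes and is nonnegative at `n`
further nodes interlacing them is zero. -/
lemma eq_zero_of_interlacing {m : ℕ} {t : Fin m → ℝ} (ht : Function.Injective t)
    {s : Finset (Fin m)} (hs : s.Nonempty) {σ : Fin m → Fin m} {ε : ℝ} (hσs : ∀ i ∈ s, σ i ∉ s)
    (hinj : Set.InjOn σ s) (hσ : ∀ i ∈ s, 0 < ε * (t (σ i) - t i))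
    (hpair : ∀ i ∈ s, ∀ b ∈ s, b ≠ i → 0 < (t (σ i) - t b) * (t (σ i) - t (σ b)))
    {q : ℝ[X]} (hq : q.natDegree ≤ 2 * s.card - 2) (h0 : ∀ i, 0 ≤ q.eval (t i))
    (hz : ∀ i ∈ s, q.eval (t i) = 0) : q = 0 := by
  classical
  have hn : 0 < s.card := hs.card_pos
  have hdisj : Disjoint s (s.image σ) := Finset.disjoint_left.2 fun i hi hi' => by
    obtain ⟨j, hj, rfl⟩ := Finset.mem_image.1 hi'
    exact hσs j hj hi
  have hcard : (s ∪ s.image σ).card = 2 * s.card := by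
    rw [Finset.card_union_of_disjoint hdisj, Finset.card_image_of_injOn hinj, two_mul]
  have hdeg : q.degree < (s ∪ s.image σ).card := by
    rw [hcard]
    exact degree_le_natDegree.trans_lt (by exact_mod_cast (by omega : q.natDegree < 2 * s.card))
  -- Interpolation at the `2n` nodes of `s ∪ σ s` expresses the coefficient of `X^(2n-1)`, which is
  -- 0. Nodes of `s` contribute nothing, and the other terms will all have the same sign.
  have hsum := Lagrange.coeff_eq_sum (v := t) ht.injOn hdeg
  rw [hcard, coeff_eq_zero_of_natDegree_lt (by omega), Finset.sum_union hdisj,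
    Finset.sum_eq_zero fun i hi => by rw [hz i hi, zero_div], zero_add,
    Finset.sum_image hinj] at hsum
  -- The factor for `i` is paired with `ε`, and the factors for `b` and `σ b` with each other.
  have hden : ∀ i ∈ s, 0 < ε * ∏ b ∈ (s ∪ s.image σ).erase (σ i), (t (σ i) - t b) := by
    intro i hi
    have h1 : (s ∪ s.image σ).erase (σ i) = s ∪ (s.erase i).image σ := by
      ext b
      simp only [Finset.mem_erase, Finset.mem_union, Finset.mem_image]
      constructor
      · rintro ⟨hb, hb' | ⟨a, ha, rfl⟩⟩
        · exact Or.inl hb'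
        · exact Or.inr ⟨a, ⟨fun h => hb (h ▸ rfl), ha⟩, rfl⟩
      · rintro (hb | ⟨a, ⟨ha, ha'⟩, rfl⟩)
        · exact ⟨fun h => hσs i hi (h ▸ hb), Or.inl hb⟩
        · exact ⟨fun h => ha (hinj ha' hi h), Or.inr ⟨a, ha', rfl⟩⟩
    rw [h1, Finset.prod_union (hdisj.mono_right (Finset.image_subset_image (Finset.erase_subset _ _))),
      Finset.prod_image (hinj.mono (Finset.erase_subset _ _)), ← Finset.mul_prod_erase s _ hi,
      mul_assoc, ← Finset.prod_mul_distrib, ← mul_assoc]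
    exact mul_pos (hσ i hi) (Finset.prod_pos fun b hb =>
      hpair i hi b (Finset.mem_of_mem_erase hb) (Finset.ne_of_mem_erase hb))
  have hε : ε ≠ 0 := by
    obtain ⟨i, hi⟩ := hs
    rintro rfl
    simpa using hσ i hi
  have hsum' : ∑ i ∈ s, q.eval (t (σ i)) /
      (ε * ∏ b ∈ (s ∪ s.image σ).erase (σ i), (t (σ i) - t b)) = 0 := by
    simp_rw [mul_comm ε, ← div_div, ← Finset.sum_div, ← hsum, zero_div]
  have hzero := (Finset.sum_eq_zero_iff_of_nonneg fun i hi =>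
    div_nonneg (h0 (σ i)) (hden i hi).le).1 hsum'
  refine eq_zero_of_natDegree_lt_card_of_eval_eq_zero' q ((s ∪ s.image σ).image t) ?_ ?_
  · intro x hx
    obtain ⟨b, hb, rfl⟩ := Finset.mem_image.1 hx
    rcases Finset.mem_union.1 hb with hb | hb
    · exact hz b hb
    · obtain ⟨i, hi, rfl⟩ := Finset.mem_image.1 hb
      exact (div_eq_zero_iff.1 (hzero i hi)).resolve_right (hden i hi).ne'
  · rw [Finset.card_image_of_injective _ ht, hcard]
    omega

/-- No node lies strictly between two consecutive ones. -/
lemma sub_mul_sub_pos_of_succ {m : ℕ} {t : Fin m → ℝ} (ht : StrictMono t) {a b c : Fin m}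
    (hbc : (c : ℕ) = b + 1 ∨ (b : ℕ) = c + 1) (hab : a ≠ b) (hac : a ≠ c) :
    0 < (t a - t b) * (t a - t c) := by
  have hab' : (a : ℕ) ≠ b := fun h => hab (Fin.ext h)
  have hac' : (a : ℕ) ≠ c := fun h => hac (Fin.ext h)
  rcases lt_or_gt_of_ne hab' with h | h
  · have h1 : t a < t b := ht h
    have h2 : t a < t c := ht (show (a : ℕ) < c by omega)
    exact mul_pos_of_neg_of_neg (by linarith) (by linarith)
  · have h1 : t b < t a := ht h
    have h2 : t c < t a := ht (show (c : ℕ) < a by omega)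
    exact mul_pos (by linarith) (by linarith)

/-- A polynomial of degree at most `2 n - 2` that is nonnegative at all nodes and vanishes on a
stable set of `n` nodes is zero. -/
lemma eq_zero_of_isStable {m : ℕ} {t : Fin m → ℝ} (ht : StrictMono t)
    {s : Finset (Fin m)} (hs : s.Nonempty) (hst : IsStable s) {q : ℝ[X]}
    (hq : q.natDegree ≤ 2 * s.card - 2) (h0 : ∀ i, 0 ≤ q.eval (t i))
    (hz : ∀ i ∈ s, q.eval (t i) = 0) : q = 0 := by
  -- A stable set cannot contain both the last and the first node. Predecessors serve as partners if
  -- it contains the last one, successors otherwise, so no partner wraps around.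
  by_cases hlast : ∃ i ∈ s, (i : ℕ) + 1 = m
  · obtain ⟨l, hl, hlm⟩ := hlast
    have hne : ∀ i ∈ s, (i : ℕ) ≠ 0 := fun i hi h => hst l hl i hi (by rw [h, hlm, Nat.mod_self])
    let σ : Fin m → Fin m := fun i => ⟨(i : ℕ) - 1, by have := i.2; omega⟩
    have hσ : ∀ i ∈ s, (i : ℕ) = σ i + 1 := fun i hi => by
      have := hne i hi
      simp only [σ]
      omega
    have hσs : ∀ i ∈ s, σ i ∉ s := fun i hi h =>
      hst _ h i hi (by rw [← hσ i hi, Nat.mod_eq_of_lt i.2])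
    have hinj : Set.InjOn σ s := fun i hi j hj h => Fin.ext (by rw [hσ i hi, hσ j hj, h])
    refine eq_zero_of_interlacing ht.injective hs (σ := σ) (ε := -1) hσs hinj ?_ ?_ hq h0 hz
    · intro i hi
      have : t (σ i) < t i := ht (show (σ i : ℕ) < i by have := hσ i hi; omega)
      linarith
    · intro i hi b hb hbi
      exact sub_mul_sub_pos_of_succ ht (Or.inr (hσ b hb)) (fun h => hσs i hi (h ▸ hb))
        fun h => hbi (hinj hb hi h.symm)
  · push Not at hlast
    have hlt : ∀ i ∈ s, (i : ℕ) + 1 < m := fun i hi => by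
      have := hlast i hi
      omega
    let σ : Fin m → Fin m := fun i => ⟨((i : ℕ) + 1) % m, Nat.mod_lt _ i.pos⟩
    have hσ : ∀ i ∈ s, (σ i : ℕ) = i + 1 := fun i hi => Nat.mod_eq_of_lt (hlt i hi)
    have hσs : ∀ i ∈ s, σ i ∉ s := fun i hi h => hst i hi _ h rfl
    have hinj : Set.InjOn σ s := fun i hi j hj h => Fin.ext (by
      have h1 := hσ i hi
      have h2 := hσ j hj
      rw [h] at h1
      omega)
    refine eq_zero_of_interlacing ht.injective hs (σ := σ) (ε := 1) hσs hinj ?_ ?_ hq h0 hz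
    · intro i hi
      have : t i < t (σ i) := ht (show (i : ℕ) < σ i by rw [hσ i hi]; omega)
      linarith
    · intro i hi b hb hbi
      exact sub_mul_sub_pos_of_succ ht (Or.inl (hσ b hb)) (fun h => hσs i hi (h ▸ hb))
        fun h => hbi (hinj hb hi h.symm)

/-- Membership in the greedy stable subset of `s`, at distance `j` after `r` in cyclic order. -/
def greedyStable {m : ℕ} (s : Finset (Fin m)) (r : Fin m) : ℕ → Prop
  | 0 => False
  | j + 1 => (∃ i ∈ s, (i : ℕ) = (r + (j + 1)) % m) ∧ ¬ greedyStable s r j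

/-- Passing to the cyclic successor increases the cyclic distance from `r` by one, except when the
successor is `r` itself. -/
lemma cyclic_succ_cases {m i j r : ℕ} (hi : i < m) (hr : r < m)
    (h : j = (i + 1) % m) : ((i + m - r) % m + 1 < m ∧ (j + m - r) % m = (i + m - r) % m + 1) ∨
      (j + m - r) % m = 0 := by
  rcases Nat.lt_or_ge (i + 1) m with h1 | h1
  · rw [Nat.mod_eq_of_lt h1] at h
    subst h
    rcases lt_trichotomy (i + 1) r with h2 | h2 | h2
    · left
      rw [Nat.mod_eq_of_lt (by omega : i + m - r < m), Nat.mod_eq_of_lt (by omega)]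
      omega
    · right
      rw [h2]
      simp
    · left
      rw [Nat.mod_eq_sub_mod (by omega : m ≤ i + m - r), Nat.mod_eq_of_lt (by omega),
        Nat.mod_eq_sub_mod (by omega), Nat.mod_eq_of_lt (by omega)]
      omega
  · have h2 : i + 1 = m := by omega
    rw [h2, Nat.mod_self] at h
    subst h
    rcases Nat.eq_zero_or_pos r with rfl | h3
    · right; simp
    · left
      rw [Nat.mod_eq_sub_mod (by omega : m ≤ i + m - r), Nat.mod_eq_of_lt (by omega),
        Nat.mod_eq_of_lt (by omega)]
      omega

lemma add_cyclic_sub {m i r : ℕ} (hi : i < m) (hr : r < m) : (r + (i + m - r) % m) % m = i := by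
  rw [Nat.add_mod_mod, show r + (i + m - r) = i + m by omega, Nat.add_mod_right,
    Nat.mod_eq_of_lt hi]

/-- Every proper subset of a cyclically ordered set is covered by the translates by zero and one of
a stable subset. -/
lemma exists_isStable_cover {m : ℕ} {s : Finset (Fin m)} (hs : s ≠ Finset.univ) :
    ∃ T ⊆ s, IsStable T ∧ ∀ i ∈ s, i ∈ T ∨ ∃ j ∈ T, (i : ℕ) = (j + 1) % m := by
  classical
  -- A point outside `s` cuts the circle open, so that the greedy choice cannot conflict with its
  -- own start.
  obtain ⟨r, hr⟩ : ∃ r, r ∉ s := by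
    by_contra! h
    exact hs (Finset.eq_univ_iff_forall.2 h)
  have hm : 0 < m := r.pos
  have key : ∀ (i : Fin m) (k : ℕ), ((i : ℕ) + m - r) % m = k + 1 →
      (greedyStable s r (k + 1) ↔ i ∈ s ∧ ¬ greedyStable s r k) := by
    intro i k hk
    rw [greedyStable, ← hk, add_cyclic_sub i.2 r.2]
    refine and_congr_left fun _ => ⟨?_, fun h => ⟨i, h, rfl⟩⟩
    rintro ⟨j, hj, hji⟩
    exact (Fin.ext hji : j = i) ▸ hj
  refine ⟨Finset.univ.filter fun i => greedyStable s r (((i : ℕ) + m - r) % m), ?_, ?_, ?_⟩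
  · intro i hi
    have hi := (Finset.mem_filter.1 hi).2
    cases hk : ((i : ℕ) + m - r) % m with
    | zero => rw [hk] at hi; exact hi.elim
    | succ k => rw [hk] at hi; exact ((key i k hk).1 hi).1
  · intro i hi j hj h
    have hi := (Finset.mem_filter.1 hi).2
    have hj := (Finset.mem_filter.1 hj).2
    rcases cyclic_succ_cases i.2 r.2 h with ⟨-, h1⟩ | h1
    · rw [h1] at hj
      exact hj.2 hi
    · rw [h1] at hj
      exact hj
  · intro i hi
    simp only [Finset.mem_filter, Finset.mem_univ, true_and]
    cases hk : ((i : ℕ) + m - r) % m with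
    | zero =>
      have h1 := add_cyclic_sub i.2 r.2
      rw [hk, add_zero, Nat.mod_eq_of_lt r.2] at h1
      exact absurd ((Fin.ext h1 : r = i) ▸ hi) hr
    | succ k =>
      by_cases hgk : greedyStable s r k
      · right
        have hkm : k + 1 < m := hk ▸ Nat.mod_lt _ hm
        let j : Fin m := ⟨(r + k) % m, Nat.mod_lt _ hm⟩
        have hij : (i : ℕ) = (j + 1) % m := by
          have h1 := add_cyclic_sub i.2 r.2
          rw [hk] at h1
          simp only [j, Nat.mod_add_mod]
          rw [← h1, add_assoc]
        refine ⟨j, ?_, hij⟩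
        rcases cyclic_succ_cases j.2 r.2 hij with ⟨-, h1⟩ | h1
        · rw [hk] at h1
          rwa [← Nat.succ.inj h1]
        · omega
      · left
        exact (key i k hk).2 ⟨hi, hgk⟩

/-- Around a pair of cyclically successive nodes there is a quadratic polynomial vanishing at the
pair and positive at all other nodes. -/
lemma exists_pair_polynomial {m : ℕ} {t : Fin m → ℝ} (ht : StrictMono t) (i j : Fin m)
    (hij : (j : ℕ) = (i + 1) % m) : ∃ q : ℝ[X], q.natDegree ≤ 2 ∧ (∀ a, 0 ≤ q.eval (t a)) ∧
      ∀ a, q.eval (t a) = 0 ↔ a = i ∨ a = j := by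
  have hdeg : ∀ x y : ℝ, ((X - C x) * (X - C y)).natDegree ≤ 2 := fun x y =>
    natDegree_mul_le.trans (by simp)
  have hroot : ∀ a, (t a - t i) * (t a - t j) = 0 ↔ a = i ∨ a = j := fun a => by
    rw [mul_eq_zero, sub_eq_zero, sub_eq_zero, ht.injective.eq_iff, ht.injective.eq_iff]
  by_cases hi : (i : ℕ) + 1 < m
  · rw [Nat.mod_eq_of_lt hi] at hij
    refine ⟨(X - C (t i)) * (X - C (t j)), hdeg _ _, fun a => ?_, fun a => by simpa using hroot a⟩
    by_cases ha : a = i ∨ a = j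
    · simpa using ((hroot a).2 ha).ge
    · push Not at ha
      simpa using (sub_mul_sub_pos_of_succ ht (Or.inl hij) ha.1 ha.2).le
  · have him : (i : ℕ) + 1 = m := by omega
    rw [him, Nat.mod_self] at hij
    refine ⟨-((X - C (t i)) * (X - C (t j))), by rw [natDegree_neg]; exact hdeg _ _, fun a => ?_,
      fun a => by rw [eval_neg, neg_eq_zero]; simpa using hroot a⟩
    have h1 : t a ≤ t i := ht.monotone (show (a : ℕ) ≤ i by omega)
    have h2 : t j ≤ t a := ht.monotone (show (j : ℕ) ≤ a by omega)
    simpa using mul_nonpos_of_nonpos_of_nonneg (sub_nonpos.2 h1) (sub_nonneg.2 h2)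

/-- The positions `0, 2, …, 2n - 2` work. This settles the full vertex set, to which the greedy
cover does not apply. -/
lemma stableSets_nonempty (n k : ℕ) : (stableSets n (2 * n + k)).Nonempty := by
  classical
  refine ⟨Finset.univ.image fun a : Fin n => (⟨2 * a, by omega⟩ : Fin (2 * n + k)), ?_, ?_⟩
  · rw [Finset.card_image_of_injective _ fun a b h => Fin.ext (by
      have := congrArg Fin.val h
      simp only at this
      omega)]
    simp
  · intro i hi j hj h
    obtain ⟨a, -, rfl⟩ := Finset.mem_image.1 hi
    obtain ⟨b, -, rfl⟩ := Finset.mem_image.1 hj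
    simp only at h
    rw [Nat.mod_eq_of_lt (by omega)] at h
    omega

/-- **Gale's evenness condition** for even-dimensional cyclic polytopes: the nonfaces are the sets
containing a stable set of `n` vertices. -/
theorem notMem_cyclicBoundary_iff {n k : ℕ} (hn : 2 ≤ n) {t : Fin (2 * n + k) → ℝ}
    (ht : StrictMono t) {s : Finset (Fin (2 * n + k))} (hs : s.Nonempty) :
    s ∉ cyclicBoundary (2 * n - 2) t ↔ ∃ T ∈ stableSets n (2 * n + k), T ⊆ s := by
  classical
  constructor
  · intro hsK
    by_cases hsu : s = Finset.univ
    · obtain ⟨T, hT⟩ := stableSets_nonempty n k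
      exact ⟨T, hT, hsu ▸ Finset.subset_univ T⟩
    obtain ⟨T, hTs, hT, hcover⟩ := exists_isStable_cover hsu
    by_contra! hno
    have hcard : T.card ≤ n - 1 := by
      by_contra! hlt
      obtain ⟨U, hUT, hU⟩ := Finset.exists_subset_card_eq (show n ≤ T.card by omega)
      exact hno U ⟨hU, fun i hi j hj => hT i (hUT hi) j (hUT hj)⟩ (hUT.trans hTs)
    let σ : Fin (2 * n + k) → Fin (2 * n + k) := fun i =>
      ⟨(i + 1) % (2 * n + k), Nat.mod_lt _ (by omega)⟩
    have hpair := fun i => exists_pair_polynomial ht i (σ i) rfl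
    choose q hq hq0 hqr using hpair
    -- At most `n - 1` quadratics give degree at most `2n - 2` and at most `2n - 2` zeros among the
    -- `2n + k` nodes, so the face is proper.
    refine hsK (mem_cyclicBoundary_iff.2 ⟨hs, ∏ i ∈ T, q i, ?_, fun a => ?_, ?_, fun a ha => ?_⟩)
    · refine (natDegree_prod_le _ _).trans ((Finset.sum_le_card_nsmul _ _ 2 fun i _ => hq i).trans ?_)
      simp only [smul_eq_mul]
      omega
    · rw [eval_prod]
      exact Finset.prod_nonneg fun i _ => hq0 i a
    · have hlt : (T ∪ T.image σ).card < (Finset.univ : Finset (Fin (2 * n + k))).card := by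
        have h1 := Finset.card_union_le T (T.image σ)
        have h2 := Finset.card_image_le (s := T) (f := σ)
        rw [Finset.card_univ, Fintype.card_fin]
        omega
      obtain ⟨a, -, ha⟩ := Finset.exists_mem_notMem_of_card_lt_card hlt
      refine ⟨a, ?_⟩
      rw [eval_prod]
      refine Finset.prod_ne_zero_iff.2 fun i hi h => ha ?_
      rcases (hqr i a).1 h with rfl | rfl
      · exact Finset.mem_union_left _ hi
      · exact Finset.mem_union_right _ (Finset.mem_image_of_mem σ hi)
    · rw [eval_prod]
      rcases hcover a ha with h | ⟨j, hj, h⟩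
      · exact Finset.prod_eq_zero h ((hqr a a).2 (Or.inl rfl))
      · exact Finset.prod_eq_zero hj ((hqr j a).2 (Or.inr (Fin.ext h)))
  · rintro ⟨T, ⟨hTn, hT⟩, hTs⟩ hsK
    obtain ⟨-, q, hq, hq0, ⟨i, hi⟩, hqs⟩ := mem_cyclicBoundary_iff.1 hsK
    have := eq_zero_of_isStable ht (Finset.card_pos.1 (by omega)) hT (by rw [hTn]; exact hq) hq0
      fun i hi => hqs i (hTs hi)
    rw [this, eval_zero] at hi
    exact hi rfl

/-- The missing faces of an even-dimensional cyclic polytope. -/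
theorem missingFaces_cyclicBoundary {n k : ℕ} (hn : 2 ≤ n) {t : Fin (2 * n + k) → ℝ}
    (ht : StrictMono t) :
    missingFaces (cyclicBoundary (2 * n - 2) t) ⊤ = stableSets n (2 * n + k) := by
  have hne : ∀ T ∈ stableSets n (2 * n + k), T.Nonempty := fun T hT =>
    Finset.card_pos.1 (by have := hT.1; omega)
  ext s
  constructor
  · intro hs
    obtain ⟨T, hT, hTs⟩ := (notMem_cyclicBoundary_iff hn ht (nonempty_of_mem_missingFaces hs)).1
      (notMem_of_mem_missingFaces hs)
    have hle : s ⊆ T := Minimal.le_of_le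
      (P := fun u => u ∈ (⊤ : PreAbstractSimplicialComplex _) ∧ u ∉ cyclicBoundary (2 * n - 2) t) hs
      ⟨hne T hT, (notMem_cyclicBoundary_iff hn ht (hne T hT)).2 ⟨T, hT, subset_rfl⟩⟩ hTs
    rwa [hle.antisymm hTs]
  · intro hs
    refine ⟨⟨hne s hs, (notMem_cyclicBoundary_iff hn ht (hne s hs)).2 ⟨s, hs, subset_rfl⟩⟩, ?_⟩
    rintro u ⟨hu, huK⟩ hus
    obtain ⟨T, hT, hTu⟩ := (notMem_cyclicBoundary_iff hn ht hu).1 huK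
    rw [← Finset.eq_of_subset_of_card_le (hTu.trans hus) (by rw [hs.1, hT.1])]
    exact hTu

/-- The boundary complex of an even-dimensional cyclic polytope is a triangulated sphere. -/
theorem isSphereTriangulation_cyclicBoundary {n k : ℕ} (hn : 2 ≤ n) {t : Fin (2 * n + k) → ℝ}
    (ht : StrictMono t) : IsSphereTriangulation (cyclicBoundary (2 * n - 2) t) (2 * n - 2) where
  singleton_mem v := by
    by_contra hv
    obtain ⟨T, hT, hTv⟩ := (notMem_cyclicBoundary_iff hn ht (Finset.singleton_nonempty v)).1 hv
    have h1 := Finset.card_le_card hTv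
    rw [hT.1, Finset.card_singleton] at h1
    omega
  homeomorphic := nonempty_realization_cyclicBoundary_homeomorph (by omega) ht.injective

end GaleEvenness

/-! ### Schrijver's theorem -/

section Schrijver

/-- The stable Kneser graph of singletons is complete. -/
lemma chromaticNumber_stableKneserGraph_one (m : ℕ) (hm : 2 ≤ m) :
    (stableKneserGraph 1 m).chromaticNumber = m := by
  have hstable : ∀ i : Fin m, ({i} : Finset (Fin m)) ∈ stableSets 1 m := by
    refine fun i => ⟨Finset.card_singleton i, fun a ha b hb h => ?_⟩
    rw [Finset.mem_singleton.1 ha, Finset.mem_singleton.1 hb] at h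
    rcases Nat.lt_or_ge ((i : ℕ) + 1) m with h1 | h1
    · rw [Nat.mod_eq_of_lt h1] at h
      omega
    · rw [show (i : ℕ) + 1 = m by omega, Nat.mod_self] at h
      omega
  let f : Fin m → stableSets 1 m := fun i => ⟨{i}, hstable i⟩
  have hf : Function.Bijective f := by
    constructor
    · intro i j h
      exact Finset.singleton_injective (congrArg Subtype.val h)
    · rintro ⟨s, hs⟩
      obtain ⟨i, rfl⟩ := Finset.card_eq_one.1 hs.1
      exact ⟨i, rfl⟩
  have htop : stableKneserGraph 1 m = ⊤ := by
    ext s u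
    refine ⟨fun h => h.1, fun h => ⟨h, ?_⟩⟩
    obtain ⟨i, rfl⟩ := hf.surjective s
    obtain ⟨j, rfl⟩ := hf.surjective u
    exact Finset.disjoint_singleton.2 fun hij => h (congrArg f hij)
  have : Fintype (stableSets 1 m) := Fintype.ofBijective f hf
  rw [htop, SimpleGraph.chromaticNumber_top, ← Fintype.card_of_bijective hf, Fintype.card_fin]

/-- **Schrijver's theorem** on the chromatic number of the stable Kneser graphs. -/
theorem chromaticNumber_stableKneserGraph (n k : ℕ) (hn : 1 ≤ n) :
    (stableKneserGraph n (2 * n + k)).chromaticNumber = (k : ℕ∞) + 2 := by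
  -- For `n = 1` the ambient space would be ℝ^0, so this case is treated directly as a complete
  -- graph.
  rcases hn.eq_or_lt with rfl | hn
  · rw [chromaticNumber_stableKneserGraph_one _ (by omega), add_comm (2 * 1) k]
    push_cast
    rfl
  · have ht : StrictMono fun i : Fin (2 * n + k) => ((i : ℕ) : ℝ) := fun i j h =>
      Nat.cast_lt.2 h
    have : Nonempty (Fin (2 * n + k)) := ⟨⟨0, by omega⟩⟩
    have h := (isSphereTriangulation_cyclicBoundary hn ht).chromaticNumber_add
    rw [kneserGraph, missingFaces_cyclicBoundary hn ht, Fintype.card_fin] at h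
    have hcard := congrArg (Nat.cast : ℕ → ℕ∞) (show 2 * n + k = k + 2 + (2 * n - 2) by omega)
    rw [Nat.cast_add (k + 2)] at hcard
    exact (ENat.add_left_injective_of_ne_top (ENat.natCast_ne_top _) (h.trans hcard)).trans (by simp)

end Schrijver

end SphereKneser

end

theorem theorem5p3 :
    -- the chromatic number is `N + 1 - d`, written without subtraction
    (∀ (d N : ℕ) (K : PreAbstractSimplicialComplex (Fin (N + 1))),
      SphereKneser.IsSphereTriangulation K d →
        (SphereKneser.kneserGraph K ⊤).chromaticNumber + (d : ℕ∞) = (N : ℕ∞) + 1) ∧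
    -- the boundary of the cyclic polytope is such a triangulation, with Kneser graph `KG'`
    (∀ (n k : ℕ) (t : Fin (2 * n + k) → ℝ), 2 ≤ n → StrictMono t →
      SphereKneser.IsSphereTriangulation (SphereKneser.cyclicBoundary (2 * n - 2) t) (2 * n - 2) ∧
      SphereKneser.missingFaces (SphereKneser.cyclicBoundary (2 * n - 2) t) ⊤ =
        SphereKneser.stableSets n (2 * n + k)) ∧
    -- Schrijver's theorem
    (∀ n k : ℕ, 1 ≤ n →
      (SphereKneser.stableKneserGraph n (2 * n + k)).chromaticNumber = (k : ℕ∞) + 2) := by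
  refine ⟨fun d N K hK => ?_, fun n k t hn ht =>
    ⟨SphereKneser.isSphereTriangulation_cyclicBoundary hn ht,
      SphereKneser.missingFaces_cyclicBoundary hn ht⟩,
    SphereKneser.chromaticNumber_stableKneserGraph⟩
  rw [hK.chromaticNumber_add, Fintype.card_fin, Nat.cast_add, Nat.cast_one]
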